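/- Write points of $\mathbb{C}^2$ as $(z,w)=(x+iy,\,u+iv)$, with weights $[z]=[\bar z]=1$, $[u]=2$: a function of $(z,u)$ near $0$ is $O(6)$ if it is bounded near $0$ by a constant times $|z|^6+|u|^3$. Let $M=\{v=F(z,\bar z,u)\}\subset\mathbb{C}^2$ be a hypersurface graphed by a real-analytic real-valued function $F$ on an open set $D\subset\mathbb{C}_z\times\mathbb{R}_u$. Moser chains. A *normalizing map* at $p\in M$ is a local biholomorphism $\varphi$ at $p$ with $\varphi(p)=0$ that sends $M$ near $p$ onto a real-analytic hypersurface $v'=z'\bar z'+O(6)$ near $0$. It acts, by its second prolongation $\varphi^{(2)}$, on the 2-jets $(x_1,y_1,x_2,y_2)$ at $p$ of CR-transversal curves $u\mapsto(x(u),y(u),u)$ in $M$ (with intrinsic coordinates $(x,y,u)$). The chain locus at $p$ is $\Sigma_p:=(\varphi^{(2)})^{-1}(\Sigma_0)$, where $$\Sigma_0:=\{x_2=-2x_1^2y_1-2y_1^3,\quad y_2=2x_1y_1^2+2x_1^3\},$$ and does not depend on the normalizing map $\varphi$ at $p$. A curve $u\mapsto(x(u),y(u),u)$ of class $C^2$ in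 $M$, defined on an open interval, is a *Moser chain* if, for every $u$, the 2-jet $(\dot x,\dot y,\ddot x,\ddot y)(u)$ belongs to $\Sigma_p$ at the corresponding point $p\in M$. Let $J\ni 0$ be an open interval such that $F(0,0,u)=0$ for all $u\in J$, and assume that the $u$-axis $\{(0,u):u\in J\}\subset M$ is a Moser chain. Then: (1) If $F(z,\bar z,u)=z\bar z+F_{3,2,0}\,z^3\bar z^2+\overline{F_{3,2,0}}\,z^2\bar z^3+O(6)$ for some $F_{3,2,0}\in\mathbb{C}$, then $F_{3,2,0}=0$. (2) Let $F_{j,k}(u):=\frac{1}{j!\,k!}\,\partial_z^j\partial_{\bar z}^kF(0,0,u)$ be the coefficients of the expansion $F=\sum_{j,k}F_{j,k}(u)\,z^j\bar z^k$. If, for all $u\in J$, one has $F_{j,0}(u)=F_{0,k}(u)=0$ for all $j,k\ge 0$, $F_{j,1}(u)=0$ for all $j\neq1$, $F_{1,k}(u)=0$ for all $k\ne1$, $F_{1,1}(u)=1$ and $F_{2,2}(u)=0$, then $F_{3,2}(u)=F_{2,3}(u)=0$ for all $u\in J$. -/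

import Mathlib

open Complex Topology Asymptotics

noncomputable section

namespace MoserChain

/-- The hypersurface `{v = F(z, z̄, u)}` of `ℂ²`, `w = u + i v`, graphed over the set `D` of
parameters `(z, u)`. -/
def hypersurface (D : Set (ℂ × ℝ)) (F : ℂ × ℝ → ℝ) : Set (ℂ × ℂ) :=
  {q | (q.1, q.2.re) ∈ D ∧ q.2.im = F (q.1, q.2.re)}

/-- The point of the graph of `F` above `(z, u)`. -/
def graphPoint (F : ℂ × ℝ → ℝ) (m : ℂ × ℝ) : ℂ × ℂ :=
  (m.1, (m.2 : ℂ) + I * (F m : ℂ))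

/-- `R = O(6)` at the origin, for the weights `[z] = [z̄] = 1` and `[u] = 2`. -/
def IsWeightedO6 (R : ℂ × ℝ → ℝ) : Prop :=
  R =O[𝓝 (0 : ℂ × ℝ)] fun m => ‖m.1‖ ^ 6 + |m.2| ^ 3

/-- `φ` is (the germ at `p` of) a biholomorphism with `φ p = 0` which sends the hypersurface `M`
near `p` to a real-analytic hypersurface `v' = z' z̄' + O(6)` near `0`. -/
structure IsNormalizingMap (M : Set (ℂ × ℂ)) (p : ℂ × ℂ) (φ : ℂ × ℂ → ℂ × ℂ) : Prop where
  analyticAt : AnalyticAt ℂ φ p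
  map_base : φ p = 0
  invertible : (fderiv ℂ φ p).IsInvertible
  normalizes : ∃ G : ℂ × ℝ → ℝ, AnalyticAt ℝ G 0 ∧
    IsWeightedO6 (fun m => G m - normSq m.1) ∧
    ∀ᶠ q in 𝓝 p, (q ∈ M ↔ (φ q).2.im = G ((φ q).1, (φ q).2.re))

/-- Fibre coordinates `(x₁, y₁, x₂, y₂)` on the space of second order jets of curves
`u ↦ (x(u), y(u))`. -/
@[ext]
structure Jet2 where
  x₁ : ℝ
  y₁ : ℝ
  x₂ : ℝ
  y₂ : ℝ

/-- The cubic surface `Σ₀` in the fibre over `0` of the second jet space. -/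
def sigmaZero : Set Jet2 :=
  {j | j.x₂ = -2 * j.x₁ ^ 2 * j.y₁ - 2 * j.y₁ ^ 3 ∧ j.y₂ = 2 * j.x₁ * j.y₁ ^ 2 + 2 * j.x₁ ^ 3}

/-- The 2-jet at parameter `t` of the curve `(X, Y, U)` once it is graphed over the `U`-axis,
that is, `(dX/dU, dY/dU, d²X/dU², d²Y/dU²)`; meaningful when `deriv U t ≠ 0`. -/
def jetOfCurve (X Y U : ℝ → ℝ) (t : ℝ) : Jet2 where
  x₁ := deriv X t / deriv U t
  y₁ := deriv Y t / deriv U t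
  x₂ := (deriv (deriv X) t * deriv U t - deriv X t * deriv (deriv U) t) / deriv U t ^ 3
  y₂ := (deriv (deriv Y) t * deriv U t - deriv Y t * deriv (deriv U) t) / deriv U t ^ 3

/-- The curve in the graph of `F` whose projection to `(x, y, u)`-space is the quadratic curve
through `m = (z_p, u_p)` at time `0`, with `u = u_p + t`, representing the 2-jet `j`. -/
def representative (F : ℂ × ℝ → ℝ) (m : ℂ × ℝ) (j : Jet2) (t : ℝ) : ℂ × ℂ :=
  graphPoint F
    (m.1 + (t : ℂ) * ((j.x₁ : ℂ) + I * (j.y₁ : ℂ))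
        + ((t ^ 2 / 2 : ℝ) : ℂ) * ((j.x₂ : ℂ) + I * (j.y₂ : ℂ)),
      m.2 + t)

/-- The `u'`-component of the image under `φ` of the representative curve. -/
def imageU (φ : ℂ × ℂ → ℂ × ℂ) (F : ℂ × ℝ → ℝ) (m : ℂ × ℝ) (j : Jet2) (t : ℝ) : ℝ :=
  (φ (representative F m j t)).2.re

/-- The second prolongation `φ⁽²⁾` on the fibre of 2-jets above the point of the graph of `F` over
`m`, read in the coordinates `(x', y', u')` of the target. -/
def prolong2 (φ : ℂ × ℂ → ℂ × ℂ) (F : ℂ × ℝ → ℝ) (m : ℂ × ℝ) (j : Jet2) : Jet2 :=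
  jetOfCurve (fun t => (φ (representative F m j t)).1.re)
    (fun t => (φ (representative F m j t)).1.im) (imageU φ F m j) 0

/-- The chain locus `Σ_p = (φ⁽²⁾)⁻¹(Σ₀)` at the point `p` of the hypersurface above `m`, where `φ`
is a normalizing map at `p`. The condition `deriv (imageU φ F m j) 0 ≠ 0` says that the jet `j` is
CR-transversal (the complex tangent line of the normalized hypersurface at `0` is `{w' = 0}`). -/
def chainLocus (D : Set (ℂ × ℝ)) (F : ℂ × ℝ → ℝ) (m : ℂ × ℝ) : Set Jet2 :=
  {j | ∃ φ : ℂ × ℂ → ℂ × ℂ, IsNormalizingMap (hypersurface D F) (graphPoint F m) φ ∧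
    deriv (imageU φ F m j) 0 ≠ 0 ∧ prolong2 φ F m j ∈ sigmaZero}

/-- The curve `u ↦ (x(u), y(u), u)`, `u ∈ J`, in the hypersurface `v = F(z, z̄, u)` (with its
intrinsic coordinates `x, y, u`) is a Moser chain: it solves the second order system whose
2-jets at each point `p` are those of `Σ_p`. -/
structure IsMoserChain (D : Set (ℂ × ℝ)) (F : ℂ × ℝ → ℝ) (J : Set ℝ) (x y : ℝ → ℝ) : Prop where
  isOpen : IsOpen J
  ordConnected : J.OrdConnected
  contDiffOn_x : ContDiffOn ℝ 2 x J
  contDiffOn_y : ContDiffOn ℝ 2 y J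
  mem : ∀ u ∈ J, ((x u : ℂ) + I * (y u : ℂ), u) ∈ D
  jet_mem : ∀ u ∈ J,
    (⟨deriv x u, deriv y u, deriv (deriv x) u, deriv (deriv y) u⟩ : Jet2) ∈
      chainLocus D F ((x u : ℂ) + I * (y u : ℂ), u)

/-- The Wirtinger operator `∂/∂z = ½ (∂/∂x - i ∂/∂y)`. -/
def dz (G : ℂ × ℝ → ℂ) (m : ℂ × ℝ) : ℂ :=
  (1 / 2 : ℂ) * (fderiv ℝ G m (1, 0) - I * fderiv ℝ G m (I, 0))

/-- The Wirtinger operator `∂/∂z̄ = ½ (∂/∂x + i ∂/∂y)`. -/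
def dzbar (G : ℂ × ℝ → ℂ) (m : ℂ × ℝ) : ℂ :=
  (1 / 2 : ℂ) * (fderiv ℝ G m (1, 0) + I * fderiv ℝ G m (I, 0))

/-- The coefficient `F_{j,k}(u)` of the expansion `F(z, z̄, u) = ∑ F_{j,k}(u) z^j z̄^k`. -/
def coeff (F : ℂ × ℝ → ℝ) (j k : ℕ) (u : ℝ) : ℂ :=
  (dzbar^[k] (dz^[j] fun m => (F m : ℂ))) (0, u) / ((j.factorial : ℂ) * (k.factorial : ℂ))

/-- The normalizations `F_{j,0} ≡ F_{0,k} ≡ 0`, `F_{j,1} ≡ 0` for `j ≠ 1`, `F_{1,k} ≡ 0` for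
`k ≠ 1`, `F_{1,1} ≡ 1` and `F_{2,2} ≡ 0` on `J`. -/
structure IsPrenormalizedOn (F : ℂ × ℝ → ℝ) (J : Set ℝ) : Prop where
  coeff_zero_right : ∀ u ∈ J, ∀ j, coeff F j 0 u = 0
  coeff_zero_left : ∀ u ∈ J, ∀ k, coeff F 0 k u = 0
  coeff_one_right : ∀ u ∈ J, ∀ j, j ≠ 1 → coeff F j 1 u = 0
  coeff_one_left : ∀ u ∈ J, ∀ k, k ≠ 1 → coeff F 1 k u = 0
  coeff_one_one : ∀ u ∈ J, coeff F 1 1 u = 1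
  coeff_two_two : ∀ u ∈ J, coeff F 2 2 u = 0

end MoserChain

end

noncomputable section

namespace MoserChain

open scoped ComplexConjugate

/-! At a point of the axis, translated to the origin, let `(f, g)` be a normalizing map, and let `a`
be the coefficient of `z³ z̄²` in the source hypersurface. Substituting the curves `t ↦ (tζ, t²s)`
of the hypersurface into `Im g = |f|² + O(6)` and comparing powers of `t` yields one identity in
`(ζ, s)` for each weight from two to five.

Divide `f` by `c 1 0`, which is nonzero, and `g` by `|c 1 0|²`. Let `B`, `K` be the resulting
coefficients of `w`, `w²` in `f`, and `T` that of `w²` in `g`. Weights three and four express the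
coefficients of `z²`, `z³`, `zw` in `f` through `B` and `Re T`. Eliminating the other unknowns from
weight five leaves `a = -4 conj (K - B (Re T + i|B|²))` (`weight_five_coeff`,
`exists_normalized_coeffs`).

On the other hand `Σ₀` is the equation `z'' = 2i |z'|² z'`. Applied to the 2-jet of the image of the
axis it says exactly `K = B (Re T + i|B|²)` (`eq_of_mem_sigmaZero`). Hence `a = 0`
(`eq_zero_of_mem_chainLocus`); any single normalizing map suffices.

Part (1) is this fact at `u = 0`. For part (2) it is applied at every point of `J`: Taylor's formula
in `z` with Wirtinger derivatives gives the required expansion with `a = F_{3,2}(u)`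
(`isBigO_of_isPrenormalizedOn`), and reality of `F` gives `F_{2,3}` as its conjugate. -/

/-! ### Weighted Taylor expansion of holomorphic germs -/

lemma pow_mul_pow_le_weighted {x y : ℝ} (hx : 0 ≤ x) (hx1 : x ≤ 1) (hy : 0 ≤ y) (hy1 : y ≤ 1)
    {j k : ℕ} (h : 6 ≤ j + 2 * k) : x ^ j * y ^ k ≤ x ^ 6 + y ^ 3 := by
  rcases le_total y (x ^ 2) with hyx | hxy
  · calc x ^ j * y ^ k ≤ x ^ j * (x ^ 2) ^ k := by gcongr
      _ = x ^ (j + 2 * k) := by rw [pow_add, pow_mul]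
      _ ≤ x ^ 6 := pow_le_pow_of_le_one hx hx1 h
      _ ≤ _ := le_add_of_nonneg_right (by positivity)
  -- Squaring allows `x ^ 2 ≤ y` to be used also when `j` is odd.
  · have : (x ^ j * y ^ k) ^ 2 ≤ (y ^ 3) ^ 2 := by
      calc (x ^ j * y ^ k) ^ 2 = (x ^ 2) ^ j * y ^ (2 * k) := by ring
        _ ≤ y ^ j * y ^ (2 * k) := by gcongr
        _ = y ^ (j + 2 * k) := by rw [pow_add]
        _ ≤ y ^ 6 := pow_le_pow_of_le_one hy hy1 h
        _ = (y ^ 3) ^ 2 := by ring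
    calc x ^ j * y ^ k ≤ y ^ 3 := le_of_sq_le_sq this (by positivity)
      _ ≤ _ := le_add_of_nonneg_left (by positivity)

lemma isBigO_monomial_weighted {j k : ℕ} (h : 6 ≤ j + 2 * k) (c : ℂ) :
    (fun q : ℂ × ℂ => c * q.1 ^ j * q.2 ^ k) =O[𝓝 0] fun q => ‖q.1‖ ^ 6 + ‖q.2‖ ^ 3 := by
  refine IsBigO.of_bound ‖c‖ ?_
  filter_upwards [Metric.ball_mem_nhds (0 : ℂ × ℂ) one_pos] with q hq
  have hq' : ‖q‖ < 1 := by simpa using hq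
  rw [Prod.norm_def, max_lt_iff] at hq'
  rw [norm_mul, norm_mul, norm_pow, norm_pow, mul_assoc, Real.norm_of_nonneg (by positivity)]
  gcongr
  exact pow_mul_pow_le_weighted (norm_nonneg _) hq'.1.le (norm_nonneg _) hq'.2.le h

/-- The restriction of an `n`-linear form on `ℂ²` to the diagonal is a binary form. -/
lemma exists_binary_form {n : ℕ} (p : (ℂ × ℂ) [×n]→L[ℂ] ℂ) :
    ∃ c : ℕ → ℂ, ∀ q : ℂ × ℂ,
      p (fun _ => q) = ∑ j ∈ Finset.range (n + 1), c j * q.1 ^ j * q.2 ^ (n - j) := by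
  classical
  refine ⟨fun j => ∑ s ∈ (Finset.univ : Finset (Fin n)).powersetCard j,
    p (s.piecewise (fun _ => (1, 0)) fun _ => (0, 1)), fun q => ?_⟩
  have hq : (fun _ : Fin n => q) = (fun _ => q.1 • (1, 0)) + fun _ => q.2 • ((0, 1) : ℂ × ℂ) := by
    ext <;> simp
  have key : ∀ s : Finset (Fin n),
      p (s.piecewise (fun _ => q.1 • ((1, 0) : ℂ × ℂ)) fun _ => q.2 • ((0, 1) : ℂ × ℂ)) =
        p (s.piecewise (fun _ => (1, 0)) fun _ => (0, 1)) * q.1 ^ s.card * q.2 ^ (n - s.card) := by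
    intro s
    have : (s.piecewise (fun _ => q.1 • ((1, 0) : ℂ × ℂ)) fun _ => q.2 • ((0, 1) : ℂ × ℂ)) =
        fun i => (s.piecewise (fun _ => q.1) fun _ => q.2) i •
          (s.piecewise (fun _ => ((1, 0) : ℂ × ℂ)) fun _ => (0, 1)) i := by
      funext i
      by_cases hi : i ∈ s <;> simp [hi]
    rw [this, p.map_smul_univ, Finset.prod_piecewise]
    simp only [Finset.inter_univ, Finset.univ_inter, Finset.prod_const, Finset.card_sdiff,
      Finset.card_univ, Fintype.card_fin, smul_eq_mul]
    ring
  rw [hq, p.map_add_univ, Finset.sum_congr rfl fun s _ => key s, ← Finset.powerset_univ,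
    Finset.sum_powerset]
  simp only [Finset.card_univ, Fintype.card_fin]
  refine Finset.sum_congr rfl fun j _ => ?_
  rw [Finset.sum_mul, Finset.sum_mul]
  refine Finset.sum_congr rfl fun s hs => ?_
  rw [(Finset.mem_powersetCard.1 hs).2]

/-- The polynomial with coefficients `c j k` of `z ^ j * w ^ k`, truncated at weight `5`. -/
def weightedPoly (c : ℕ → ℕ → ℂ) (q : ℂ × ℂ) : ℂ :=
  c 0 0 + c 1 0 * q.1 + (c 2 0 * q.1 ^ 2 + c 0 1 * q.2) + (c 3 0 * q.1 ^ 3 + c 1 1 * q.1 * q.2)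
    + (c 4 0 * q.1 ^ 4 + c 2 1 * q.1 ^ 2 * q.2 + c 0 2 * q.2 ^ 2)
    + (c 5 0 * q.1 ^ 5 + c 3 1 * q.1 ^ 3 * q.2 + c 1 2 * q.1 * q.2 ^ 2)

lemma exists_weightedPoly {f : ℂ × ℂ → ℂ} (hf : AnalyticAt ℂ f 0) :
    ∃ c : ℕ → ℕ → ℂ,
      (fun q => f q - weightedPoly c q) =O[𝓝 0] fun q => ‖q.1‖ ^ 6 + ‖q.2‖ ^ 3 := by
  obtain ⟨p, hp⟩ := hf
  choose c hc using fun n => exists_binary_form (p n)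
  refine ⟨fun j k => c (j + k) j, ?_⟩
  have h1 : (fun q => f q - p.partialSum 6 q) =O[𝓝 0] fun q : ℂ × ℂ => ‖q.1‖ ^ 6 + ‖q.2‖ ^ 3 := by
    have h := hp.isBigO_sub_partialSum_pow 6
    simp only [zero_add] at h
    refine h.trans (IsBigO.of_bound 1 ?_)
    filter_upwards [Metric.ball_mem_nhds (0 : ℂ × ℂ) one_pos] with q hq
    have hq' : ‖q‖ < 1 := by simpa using hq
    rw [Prod.norm_def, max_lt_iff] at hq'
    rw [one_mul, norm_pow, norm_norm, Real.norm_of_nonneg (by positivity), Prod.norm_def]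
    rcases max_choice ‖q.1‖ ‖q.2‖ with h | h <;> rw [h]
    · exact le_add_of_nonneg_right (by positivity)
    · exact (pow_le_pow_of_le_one (norm_nonneg _) hq'.2.le (by norm_num)).trans
        (le_add_of_nonneg_left (by positivity))
  -- The nine monomials of degree at most five and weight at least six are what separates the
  -- ordinary partial sum from the weighted truncation.
  have m := fun (j k : ℕ) (h : 6 ≤ j + 2 * k) => isBigO_monomial_weighted h (c (j + k) j)
  have h2 := (((((((((h1.add (m 0 3 (by norm_num))).add (m 2 2 (by norm_num))).add
    (m 1 3 (by norm_num))).add (m 0 4 (by norm_num))).add (m 4 1 (by norm_num))).add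
    (m 3 2 (by norm_num))).add (m 2 3 (by norm_num))).add (m 1 4 (by norm_num))).add
    (m 0 5 (by norm_num)))
  refine h2.congr_left fun q => ?_
  simp only [FormalMultilinearSeries.partialSum, hc, Finset.sum_range_succ, Finset.sum_range_zero,
    weightedPoly]
  norm_num
  ring

/-! ### Expansions along weighted curves -/

/-- A polynomial of degree `< n` which is `O(t ^ n)` vanishes. -/
lemma coeff_eq_zero_of_isBigO {n : ℕ} {c : ℕ → ℝ}
    (h : (fun t : ℝ => ∑ k ∈ Finset.range n, c k * t ^ k) =O[𝓝[≠] 0] fun t => t ^ n) :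
    ∀ k < n, c k = 0 := by
  induction n generalizing c with
  | zero => simp
  | succ n ih =>
    have hc0 : c 0 = 0 := by
      have h1 : Filter.Tendsto (fun t : ℝ => t ^ (n + 1)) (𝓝[≠] 0) (𝓝 0) := by
        have : Filter.Tendsto (fun t : ℝ => t ^ (n + 1)) (𝓝 0) (𝓝 (0 ^ (n + 1))) :=
          (continuous_pow (n + 1)).tendsto 0
        rw [zero_pow (Nat.succ_ne_zero n)] at this
        exact this.mono_left nhdsWithin_le_nhds
      have h2 := h.trans_tendsto h1
      have h3 : Filter.Tendsto (fun t : ℝ => ∑ k ∈ Finset.range (n + 1), c k * t ^ k) (𝓝[≠] 0)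
          (𝓝 (c 0)) := by
        have hcont : Continuous fun t : ℝ => ∑ k ∈ Finset.range (n + 1), c k * t ^ k := by fun_prop
        have := hcont.tendsto 0
        rw [Finset.sum_range_succ'] at this
        simp only [ne_eq, Nat.add_eq_zero_iff, one_ne_zero, and_false, not_false_eq_true, zero_pow,
          mul_zero, Finset.sum_const_zero, pow_zero, mul_one, zero_add] at this
        exact this.mono_left nhdsWithin_le_nhds
      exact tendsto_nhds_unique h3 h2
    -- Division by `t` is legitimate because the filter is punctured at `0`.
    have hs : (fun t : ℝ => ∑ k ∈ Finset.range n, c (k + 1) * t ^ k) =O[𝓝[≠] 0]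
        fun t => t ^ n := by
      have h1 := (isBigO_refl (fun t : ℝ => t⁻¹) (𝓝[≠] 0)).mul h
      refine h1.congr' ?_ ?_
      · filter_upwards [self_mem_nhdsWithin] with t ht
        have ht : t ≠ 0 := ht
        rw [Finset.sum_range_succ', hc0, zero_mul, add_zero, Finset.mul_sum]
        refine Finset.sum_congr rfl fun k _ => ?_
        field_simp
        ring
      · filter_upwards [self_mem_nhdsWithin] with t ht
        have ht : t ≠ 0 := ht
        field_simp
        ring
    intro k hk
    cases k with
    | zero => exact hc0
    | succ k => exact ih hs k (by omega)

lemma isBigO_pow_pow {m n : ℕ} (h : n ≤ m) :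
    (fun t : ℝ => t ^ m) =O[𝓝 0] fun t : ℝ => t ^ n := by
  rcases h.lt_or_eq with h | rfl
  · exact (isLittleO_pow_pow h).isBigO
  · exact isBigO_refl _ _

lemma isBigO_const_mul_ofReal_pow (c : ℂ) {m n : ℕ} (h : n ≤ m) :
    (fun t : ℝ => c * (t : ℂ) ^ m) =O[𝓝 0] fun t : ℝ => t ^ n := by
  refine (IsBigO.of_bound ‖c‖ (.of_forall fun t => ?_)).trans (isBigO_pow_pow h)
  simp

/-- Expansion of a holomorphic function along a weighted curve. -/
lemma isBigO_comp_weightedCurve {g : ℂ × ℂ → ℂ} {d : ℕ → ℕ → ℂ}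
    (hg : (fun q => g q - weightedPoly d q) =O[𝓝 0] fun q => ‖q.1‖ ^ 6 + ‖q.2‖ ^ 3)
    {ζ ω n : ℂ} {w : ℝ → ℂ}
    (hw : (fun t : ℝ => w t - (ω * (t : ℂ) ^ 2 + n * (t : ℂ) ^ 5)) =O[𝓝 0] fun t : ℝ => t ^ 6) :
    (fun t : ℝ => g ((t : ℂ) * ζ, w t) - (d 0 0 + d 1 0 * ζ * t + (d 2 0 * ζ ^ 2 + d 0 1 * ω) * t ^ 2
      + (d 3 0 * ζ ^ 3 + d 1 1 * ζ * ω) * t ^ 3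
      + (d 4 0 * ζ ^ 4 + d 2 1 * ζ ^ 2 * ω + d 0 2 * ω ^ 2) * t ^ 4
      + (d 5 0 * ζ ^ 5 + d 3 1 * ζ ^ 3 * ω + d 1 2 * ζ * ω ^ 2 + d 0 1 * n) * t ^ 5))
      =O[𝓝 0] fun t : ℝ => t ^ 6 := by
  have hδ : (fun t : ℝ => w t - ω * (t : ℂ) ^ 2) =O[𝓝 0] fun t : ℝ => t ^ 5 := by
    refine ((hw.trans (isBigO_pow_pow (by norm_num))).add
      (isBigO_const_mul_ofReal_pow n le_rfl)).congr_left fun t => ?_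
    ring
  have hw2 : w =O[𝓝 0] fun t : ℝ => t ^ 2 := by
    refine ((hδ.trans (isBigO_pow_pow (by norm_num))).add
      (isBigO_const_mul_ofReal_pow ω le_rfl)).congr_left fun t => ?_
    ring
  have hz : (fun t : ℝ => (t : ℂ) * ζ) =O[𝓝 0] fun t : ℝ => t := by
    simpa [mul_comm] using isBigO_const_mul_ofReal_pow ζ (m := 1) (n := 1) le_rfl
  have htend : Filter.Tendsto (fun t : ℝ => ((t : ℂ) * ζ, w t)) (𝓝 0) (𝓝 0) := by
    refine Filter.Tendsto.prodMk_nhds (hz.trans_tendsto Filter.tendsto_id)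
      (hw2.trans_tendsto ?_)
    simpa using (continuous_pow 2).tendsto (0 : ℝ)
  have h0 : (fun t : ℝ => g ((t : ℂ) * ζ, w t) - weightedPoly d ((t : ℂ) * ζ, w t))
      =O[𝓝 0] fun t : ℝ => t ^ 6 := by
    refine (hg.comp_tendsto htend).trans ?_
    refine (IsBigO.add (g := fun t : ℝ => t ^ 6) (hz.norm_left.pow 6) ?_)
    exact (hw2.norm_left.pow 3).congr_right fun t => by ring
  -- Since `w t - ω t²` is `O(t⁵)`, replacing `w` by `ω t²` costs only `O(t⁶)` in every monomial
  -- other than `d 0 1 * w`; the correction `n t⁵` is seen by that monomial alone.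
  have e1 : ∀ (c : ℂ), (fun t : ℝ => c * (t : ℂ) ^ 1 * (w t - ω * (t : ℂ) ^ 2))
      =O[𝓝 0] fun t : ℝ => t ^ 6 := fun c =>
    ((isBigO_const_mul_ofReal_pow c (m := 1) le_rfl).mul hδ).congr_right fun t => by ring
  have e2 : ∀ (c : ℂ), (fun t : ℝ => c * (t : ℂ) ^ 2 * (w t - ω * (t : ℂ) ^ 2))
      =O[𝓝 0] fun t : ℝ => t ^ 6 := fun c =>
    ((isBigO_const_mul_ofReal_pow c (m := 2) (n := 1) (by norm_num)).mul hδ).congr_right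
      fun t => by ring
  have e3 : ∀ (c : ℂ), (fun t : ℝ => c * (t : ℂ) ^ 3 * (w t - ω * (t : ℂ) ^ 2))
      =O[𝓝 0] fun t : ℝ => t ^ 6 := fun c =>
    ((isBigO_const_mul_ofReal_pow c (m := 3) (n := 1) (by norm_num)).mul hδ).congr_right
      fun t => by ring
  have hsum : (fun t : ℝ => w t + ω * (t : ℂ) ^ 2) =O[𝓝 0] fun t : ℝ => t ^ 1 :=
    (hw2.add (isBigO_const_mul_ofReal_pow ω le_rfl)).trans (isBigO_pow_pow (by norm_num))
  have e4 : (fun t : ℝ => (w t + ω * (t : ℂ) ^ 2) * (w t - ω * (t : ℂ) ^ 2))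
      =O[𝓝 0] fun t : ℝ => t ^ 6 := (hsum.mul hδ).congr_right fun t => by ring
  have e5 : (fun t : ℝ => d 1 2 * ζ * (t : ℂ) ^ 1 *
      ((w t + ω * (t : ℂ) ^ 2) * (w t - ω * (t : ℂ) ^ 2))) =O[𝓝 0] fun t : ℝ => t ^ 6 :=
    ((isBigO_const_mul_ofReal_pow (d 1 2 * ζ) (m := 1) (n := 0) (by norm_num)).mul e4).congr_right
      fun t => by ring
  refine ((((((h0.add (hw.const_mul_left (d 0 1))).add (e1 (d 1 1 * ζ))).add
    (e2 (d 2 1 * ζ ^ 2))).add (e4.const_mul_left (d 0 2))).add (e3 (d 3 1 * ζ ^ 3))).add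
    e5).congr_left fun t => ?_
  simp only [weightedPoly]
  ring

/-- Comparison of the Taylor coefficients in `Im g = |f|² + O(t⁶)`. -/
lemma coeff_equations {f g : ℝ → ℂ} {p₁ p₂ p₃ p₄ r₁ r₂ r₃ r₄ r₅ : ℂ}
    (hf : (fun t : ℝ => f t - (p₁ * t + p₂ * t ^ 2 + p₃ * t ^ 3 + p₄ * t ^ 4))
      =O[𝓝 0] fun t : ℝ => t ^ 5)
    (hg : (fun t : ℝ => g t - (r₁ * t + r₂ * t ^ 2 + r₃ * t ^ 3 + r₄ * t ^ 4 + r₅ * t ^ 5))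
      =O[𝓝 0] fun t : ℝ => t ^ 6)
    (h : (fun t => (g t).im - normSq (f t)) =O[𝓝 0] fun t : ℝ => t ^ 6) :
    r₂.im = normSq p₁ ∧ r₃.im = 2 * (p₁ * conj p₂).re ∧
      r₄.im = 2 * (p₁ * conj p₃).re + normSq p₂ ∧
      r₅.im = 2 * (p₁ * conj p₄).re + 2 * (p₂ * conj p₃).re := by
  set P : ℝ → ℂ := fun t => p₁ * t + p₂ * t ^ 2 + p₃ * t ^ 3 + p₄ * t ^ 4 with hP
  have hP1 : P =O[𝓝 0] fun t : ℝ => t ^ 1 := by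
    refine (((isBigO_const_mul_ofReal_pow p₁ (m := 1) le_rfl).add
      (isBigO_const_mul_ofReal_pow p₂ (m := 2) (by norm_num))).add
      (isBigO_const_mul_ofReal_pow p₃ (m := 3) (by norm_num))).add
      (isBigO_const_mul_ofReal_pow p₄ (m := 4) (by norm_num)) |>.congr_left fun t => ?_
    simp [hP]
  have hf1 : (fun t => f t + P t) =O[𝓝 0] fun t : ℝ => t ^ 1 := by
    refine (((hf.trans (isBigO_pow_pow (by norm_num))).add hP1).add hP1).congr_left fun t => ?_
    ring
  -- `|f|² - |P|² = Re ((f - P) conj (f + P))` is a product of an `O(t⁵)` and an `O(t)`, so `f` need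
  -- only be known to order four.
  have hn : (fun t => normSq (f t) - normSq (P t)) =O[𝓝 0] fun t : ℝ => t ^ 6 := by
    have h1 : (fun t => (f t - P t) * conj (f t + P t)) =O[𝓝 0] fun t : ℝ => t ^ 6 := by
      refine (hf.mul (g₁ := fun t : ℝ => t ^ 5) (g₂ := fun t : ℝ => t ^ 1) ?_).congr_right
        fun t => by ring
      exact (hf1.norm_left.congr_left fun t => (RCLike.norm_conj _).symm).of_norm_left
    refine (IsBigO.of_bound 1 (.of_forall fun t => ?_)).trans h1
    have : normSq (f t) - normSq (P t) = ((f t - P t) * conj (f t + P t)).re := by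
      simp [normSq_apply]; ring
    rw [this, one_mul]
    exact Complex.abs_re_le_norm _
  have hgi : (fun t : ℝ => (g t - (r₁ * t + r₂ * t ^ 2 + r₃ * t ^ 3 + r₄ * t ^ 4 + r₅ * t ^ 5)).im)
      =O[𝓝 0] fun t : ℝ => t ^ 6 :=
    (IsBigO.of_bound 1 (.of_forall fun t => by
      rw [one_mul]; exact Complex.abs_im_le_norm _)).trans hg
  have hrest : (fun t : ℝ => t ^ 6 * (2 * (p₂ * conj p₄).re + normSq p₃
      + 2 * (p₃ * conj p₄).re * t + normSq p₄ * t ^ 2)) =O[𝓝 0] fun t : ℝ => t ^ 6 := by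
    have hc : Continuous fun t : ℝ => 2 * (p₂ * conj p₄).re + normSq p₃
      + 2 * (p₃ * conj p₄).re * t + normSq p₄ * t ^ 2 := by fun_prop
    simpa using (isBigO_refl (fun t : ℝ => t ^ 6) (𝓝 0)).mul ((hc.tendsto 0).isBigO_one ℝ)
  have key := ((h.sub hgi).add hn).add hrest
  have := coeff_eq_zero_of_isBigO (n := 6) (c := fun k => match k with
    | 1 => r₁.im
    | 2 => r₂.im - normSq p₁
    | 3 => r₃.im - 2 * (p₁ * conj p₂).re
    | 4 => r₄.im - (2 * (p₁ * conj p₃).re + normSq p₂)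
    | 5 => r₅.im - (2 * (p₁ * conj p₄).re + 2 * (p₂ * conj p₃).re)
    | _ => 0) ((key.mono nhdsWithin_le_nhds).congr_left fun t => by
      simp only [Finset.sum_range_succ, Finset.sum_range_zero, hP, ← ofReal_pow, normSq_apply,
        sub_im, add_im, add_re, mul_re, mul_im, ofReal_re, ofReal_im, conj_re, conj_im]
      ring)
  refine ⟨?_, ?_, ?_, ?_⟩
  · exact sub_eq_zero.1 (this 2 (by norm_num))
  · exact sub_eq_zero.1 (this 3 (by norm_num))
  · exact sub_eq_zero.1 (this 4 (by norm_num))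
  · exact sub_eq_zero.1 (this 5 (by norm_num))

/-! ### Algebra of the identities of weight three, four and five -/

/-- The coefficient of `sζ` gives `Q = 2i conj B` and that of `ζ²ζ̄` gives `Q = 2A - 2i conj B`. A
finite sample of values `(ζ, s)` replaces the comparison of coefficients. -/
lemma weight_three_relation {P Q A B : ℂ}
    (h : ∀ (ζ : ℂ) (s : ℝ), (P * ζ ^ 3 + Q * ζ * (s + I * normSq ζ)).im =
      2 * (ζ * conj (A * ζ ^ 2 + B * (s + I * normSq ζ))).re) :
    A = 2 * I * conj B := by
  have a1 := h 1 0
  have a2 := h 1 1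
  have a3 := h I 0
  have a4 := h I 1
  have a5 := h (-1) 1
  have a6 := h (1 + I) 0
  have a7 := h (1 - I) 0
  simp only [pow_succ, pow_zero, one_mul, mul_one, normSq_apply, map_add, map_mul, add_im, add_re,
    mul_re, mul_im, ofReal_re, ofReal_im, conj_re, conj_im, I_re, I_im, one_re, one_im, neg_re,
    neg_im, sub_re, sub_im] at a1 a2 a3 a4 a5 a6 a7
  norm_num at a1 a2 a3 a4 a5 a6 a7
  refine Complex.ext ?_ ?_ <;>
    norm_num [mul_re, mul_im] <;> linarith

/-- The coefficients of `sζ²` and `ζ³ζ̄` determine `C`, those of `s²`, `s|ζ|²` and `|ζ|⁴` determine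
`D`. Substituting `A` first makes all quadratic terms quadratic in `B`, so the sampled equations
become linear once those products are treated as unknowns. -/
lemma weight_four_relations {R S T C D A B : ℂ}
    (hA : A = 2 * I * conj B)
    (h : ∀ (ζ : ℂ) (s : ℝ), (R * ζ ^ 4 + S * ζ ^ 2 * (s + I * normSq ζ)
        + T * (s + I * normSq ζ) ^ 2).im =
      2 * (ζ * conj (C * ζ ^ 3 + D * ζ * (s + I * normSq ζ))).re
        + normSq (A * ζ ^ 2 + B * (s + I * normSq ζ))) :
    C = -4 * conj B ^ 2 ∧ D = T.re + 3 * I * normSq B := by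
  have hA1 : A.re = 2 * B.im := by rw [hA]; simp [mul_re, mul_im]
  have hA2 : A.im = 2 * B.re := by rw [hA]; simp [mul_re, mul_im]
  have a0 := h 0 1
  have a1 := h 1 0
  have a2 := h 1 1
  have a3 := h I 0
  have a4 := h I 1
  have a5 := h 1 (-1)
  have a5' := h I (-1)
  have a6 := h (1 + I) 0
  have a7 := h (1 - I) 0
  have a8 := h (1 + I) 1
  have a9 := h (1 + I) (-1)
  have a10 := h (1 + 2 * I) 0
  have a11 := h (1 - 2 * I) 0
  simp only [pow_succ, pow_zero, one_mul, mul_one, normSq_apply, map_add, map_mul, add_im, add_re,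
    mul_re, mul_im, ofReal_re, ofReal_im, conj_re, conj_im, I_re, I_im, one_re, one_im, sub_re,
    sub_im, hA1, hA2, re_ofNat, im_ofNat, zero_re, zero_im]
    at a0 a1 a2 a3 a4 a5 a5' a6 a7 a8 a9 a10 a11
  ring_nf at a0 a1 a2 a3 a4 a5 a5' a6 a7 a8 a9 a10 a11
  refine ⟨Complex.ext ?_ ?_, Complex.ext ?_ ?_⟩ <;>
    simp [mul_re, mul_im, normSq_apply, pow_two] <;> linarith

/-- These monomials and their conjugates are linearly independent, so finitely many sample points
suffice. Only the coefficients needed for the elimination are recorded. -/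
lemma coeff_eq_zero_of_weight_five {c₁ c₂ c₃ d₁ d₂ e : ℂ}
    (h : ∀ (ζ : ℂ) (s : ℝ), (c₁ * ζ ^ 5 + c₂ * ζ ^ 4 * conj ζ + c₃ * ζ ^ 3 * conj ζ ^ 2
      + s * (d₁ * ζ ^ 3 + d₂ * ζ ^ 2 * conj ζ) + s ^ 2 * (e * ζ)).re = 0) :
    c₃ = 0 ∧ d₂ = 0 ∧ e = 0 := by
  have a1 := h 1 0
  have a2 := h 1 1
  have a3 := h 1 (-1)
  have b1 := h I 0
  have b2 := h I 1
  have b3 := h I (-1)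
  have c1 := h (1 + I) 0
  have c2 := h (1 + I) 1
  have c3 := h (1 + I) (-1)
  have d1 := h (1 - I) 0
  have d2 := h (1 - I) 1
  have d3 := h (1 - I) (-1)
  have e1 := h (1 + 2 * I) 0
  have e2 := h (1 - 2 * I) 0
  simp only [pow_succ, pow_zero, one_mul, mul_one, map_add, map_mul, map_sub, map_one, conj_I,
    map_ofNat, add_im, add_re, mul_re, mul_im, ofReal_re, ofReal_im, I_re, I_im, one_re, one_im,
    neg_re, neg_im, sub_re, sub_im, re_ofNat, im_ofNat]
    at a1 a2 a3 b1 b2 b3 c1 c2 c3 d1 d2 d3 e1 e2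
  ring_nf at a1 a2 a3 b1 b2 b3 c1 c2 c3 d1 d2 d3 e1 e2
  refine ⟨Complex.ext ?_ ?_, Complex.ext ?_ ?_, Complex.ext ?_ ?_⟩ <;>
    simp only [zero_re, zero_im] <;> linarith

lemma weight_five_relations {V W Y E H K C D A B a : ℂ}
    (h : ∀ (ζ : ℂ) (s : ℝ), (V * ζ ^ 5 + W * ζ ^ 3 * (s + I * normSq ζ)
        + Y * ζ * (s + I * normSq ζ) ^ 2).im + 2 * (a * ζ ^ 3 * conj ζ ^ 2).re =
      2 * (ζ * conj (E * ζ ^ 4 + H * ζ ^ 2 * (s + I * normSq ζ) + K * (s + I * normSq ζ) ^ 2)).re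
        + 2 * ((A * ζ ^ 2 + B * (s + I * normSq ζ))
          * conj (C * ζ ^ 3 + D * ζ * (s + I * normSq ζ))).re) :
    Y = 2 * I * (conj K + conj B * D) ∧ Y = H - 2 * I * conj K + A * conj D ∧
      2 * a = -I * Y + 2 * (I * H - conj K + conj A * C + conj B * D - I * A * conj D) := by
  -- The coefficients of left side minus right side, sorted by bidegree in `ζ`, `ζ̄` and by degree
  -- in `s`, after expanding `s + iζζ̄` and using `Im x = Re (-ix)`. Terms with more `ζ̄` than `ζ`
  -- are conjugated inside the real part.
  obtain ⟨h₁, h₂, h₃⟩ := coeff_eq_zero_of_weight_five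
    (c₁ := -I * V) (c₂ := W - 2 * E + 2 * I * conj B * C)
    (c₃ := I * Y + 2 * a - 2 * (I * H - conj K + conj A * C + conj B * D - I * A * conj D))
    (d₁ := -I * W - 2 * conj B * C) (d₂ := 2 * (Y - H + 2 * I * conj K - A * conj D))
    (e := -I * Y - 2 * conj K - 2 * conj B * D) fun ζ s => by
      rw [← sub_eq_zero.2 (h ζ s)]
      simp only [pow_succ, pow_zero, one_mul, normSq_apply, map_add, map_mul, add_im, add_re,
        mul_re, mul_im, ofReal_re, ofReal_im, conj_re, conj_im, I_re, I_im, neg_re, neg_im, sub_re,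
        sub_im, re_ofNat, im_ofNat]
      ring
  refine ⟨?_, ?_, ?_⟩
  · linear_combination I * h₃ + (Y : ℂ) * I_sq
  · linear_combination h₂ / 2
  · linear_combination h₁

/-- The coefficient of the term of weight five in the defining function, in terms of the Taylor
coefficients of a map to a hypersurface without terms of weight `3`, `4`, `5`. -/
lemma weight_five_coeff {P Q R S T V W Y A B C D E H K a : ℂ}
    (h₃ : ∀ (ζ : ℂ) (s : ℝ), (P * ζ ^ 3 + Q * ζ * (s + I * normSq ζ)).im =
      2 * (ζ * conj (A * ζ ^ 2 + B * (s + I * normSq ζ))).re)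
    (h₄ : ∀ (ζ : ℂ) (s : ℝ), (R * ζ ^ 4 + S * ζ ^ 2 * (s + I * normSq ζ)
        + T * (s + I * normSq ζ) ^ 2).im =
      2 * (ζ * conj (C * ζ ^ 3 + D * ζ * (s + I * normSq ζ))).re
        + normSq (A * ζ ^ 2 + B * (s + I * normSq ζ)))
    (h₅ : ∀ (ζ : ℂ) (s : ℝ), (V * ζ ^ 5 + W * ζ ^ 3 * (s + I * normSq ζ)
        + Y * ζ * (s + I * normSq ζ) ^ 2).im + 2 * (a * ζ ^ 3 * conj ζ ^ 2).re =
      2 * (ζ * conj (E * ζ ^ 4 + H * ζ ^ 2 * (s + I * normSq ζ) + K * (s + I * normSq ζ) ^ 2)).re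
        + 2 * ((A * ζ ^ 2 + B * (s + I * normSq ζ))
          * conj (C * ζ ^ 3 + D * ζ * (s + I * normSq ζ))).re) :
    a = -4 * conj (K - B * (T.re + I * normSq B)) := by
  have hA := weight_three_relation h₃
  obtain ⟨hC, hD⟩ := weight_four_relations hA h₄
  obtain ⟨hY, hH, ha⟩ := weight_five_relations h₅
  have hB : (normSq B : ℂ) = conj B * B := normSq_eq_conj_mul_self
  have hH' : H = Y + 2 * I * conj K - A * conj D := by rw [hH]; ring
  have hAc : conj A = -2 * I * B := by rw [hA]; simp [map_ofNat]
  have hDc : conj D = T.re - 3 * I * normSq B := by rw [hD]; simp [map_ofNat]; ring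
  rw [hH', hY, hAc, hDc, hA, hC, hD, hB] at ha
  simp only [map_sub, map_mul, map_add, conj_ofReal, conj_I, hB, conj_conj]
  linear_combination (1 / 2 : ℂ) * ha +
    (3 * conj K - 3 * conj B * T.re + 15 * I * conj B ^ 2 * B) * I_sq

/-! ### Equations satisfied by a normalizing map -/

/-- The case `k = 1` serves while the linear term of `g` in `z` is not yet excluded; once it is, `k
= 2` gives the sharp `O(t⁶)`. -/
lemma isBigO_weighted_comp {R : ℂ × ℝ → ℝ} (hR : IsWeightedO6 R) {k : ℕ} (hk : k ≠ 0)
    (hk2 : k ≤ 2) {x y : ℝ → ℂ} (hx : x =O[𝓝 0] fun t : ℝ => t)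
    (hy : y =O[𝓝 0] fun t : ℝ => t ^ k) :
    (fun t => R (x t, (y t).re)) =O[𝓝 0] fun t : ℝ => t ^ (3 * k) := by
  have hyr : (fun t => (y t).re) =O[𝓝 0] fun t : ℝ => t ^ k :=
    (IsBigO.of_bound 1 (.of_forall fun t => by
      rw [one_mul]; exact Complex.abs_re_le_norm _)).trans hy
  have htend : Filter.Tendsto (fun t : ℝ => (x t, (y t).re)) (𝓝 0) (𝓝 0) := by
    refine Filter.Tendsto.prodMk_nhds (hx.trans_tendsto Filter.tendsto_id)
      (hyr.trans_tendsto ?_)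
    simpa [hk] using (continuous_pow k).tendsto (0 : ℝ)
  refine (hR.comp_tendsto htend).trans (IsBigO.add (g := fun t : ℝ => t ^ (3 * k)) ?_ ?_)
  · exact (hx.norm_left.pow 6).trans (isBigO_pow_pow (by omega))
  · exact (hyr.norm_left.pow 3).congr_right fun t => by rw [← pow_mul, mul_comm]

/-- The model `z z̄ + a z³ z̄² + ā z² z̄³` of weight at most five. -/
def modelFive (a z : ℂ) : ℝ :=
  (z * conj z + a * z ^ 3 * conj z ^ 2 + conj a * z ^ 2 * conj z ^ 3).re

lemma modelFive_ofReal_mul (a ζ : ℂ) (t : ℝ) :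
    modelFive a (t * ζ) = normSq ζ * t ^ 2 + 2 * (a * ζ ^ 3 * conj ζ ^ 2).re * t ^ 5 := by
  simp only [modelFive, pow_succ, pow_zero, one_mul, normSq_apply, map_mul, conj_ofReal, add_re,
    mul_re, mul_im, ofReal_re, ofReal_im, conj_re, conj_im]
  ring

/-- The model has no terms of weight three or four, so the lifted curve is `ω t²` up to a single
correction of order five, which carries `a`. -/
lemma isBigO_weightedCurve {F : ℂ × ℝ → ℝ} {a : ℂ}
    (hF : IsWeightedO6 fun m => F m - modelFive a m.1) (ζ : ℂ) (s : ℝ) :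
    (fun t : ℝ => (((t ^ 2 * s : ℝ) : ℂ) + I * (F (t * ζ, t ^ 2 * s) : ℂ)) -
      ((s + I * normSq ζ) * (t : ℂ) ^ 2 + (I * (2 * (a * ζ ^ 3 * conj ζ ^ 2).re : ℝ)) * (t : ℂ) ^ 5))
      =O[𝓝 0] fun t : ℝ => t ^ 6 := by
  have h1 := isBigO_weighted_comp hF (k := 2) (by norm_num) le_rfl
    (x := fun t : ℝ => t * ζ) (y := fun t : ℝ => ((t ^ 2 * s : ℝ) : ℂ))
    (by simpa [mul_comm] using isBigO_const_mul_ofReal_pow ζ (m := 1) (n := 1) le_rfl)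
    (by simpa [mul_comm] using isBigO_const_mul_ofReal_pow (s : ℂ) (m := 2) (n := 2) le_rfl)
  have h2 : (fun t : ℝ => I * ((F (t * ζ, t ^ 2 * s) - modelFive a (t * ζ) : ℝ) : ℂ)) =O[𝓝 0]
      fun t : ℝ => t ^ 6 := by
    refine (IsBigO.of_bound 1 (.of_forall fun t => ?_)).trans h1
    rw [norm_mul, norm_I, norm_real, ofReal_re]
  refine h2.congr_left fun t => ?_
  rw [modelFive_ofReal_mul]
  push_cast
  ring

lemma truncations_of_expansion {h : ℝ → ℂ} {e₀ e₁ e₂ e₃ e₄ e₅ : ℂ} (he : e₀ = 0)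
    (H : (fun t : ℝ => h t - (e₀ + e₁ * t + e₂ * t ^ 2 + e₃ * t ^ 3 + e₄ * t ^ 4 + e₅ * t ^ 5))
      =O[𝓝 0] fun t : ℝ => t ^ 6) :
    (fun t : ℝ => h t - (e₁ * t + e₂ * t ^ 2 + e₃ * t ^ 3 + e₄ * t ^ 4))
        =O[𝓝 0] (fun t : ℝ => t ^ 5) ∧
      (fun t : ℝ => h t - e₁ * t) =O[𝓝 0] (fun t : ℝ => t ^ 2) ∧
      h =O[𝓝 0] fun t : ℝ => t := by
  have O := fun (x : ℂ) (m n : ℕ) (h : n ≤ m) => isBigO_const_mul_ofReal_pow x h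
  have h5 : (fun t : ℝ => h t - (e₁ * t + e₂ * t ^ 2 + e₃ * t ^ 3 + e₄ * t ^ 4))
      =O[𝓝 0] (fun t : ℝ => t ^ 5) :=
    ((H.trans (isBigO_pow_pow (by norm_num))).add (O e₅ 5 5 le_rfl)).congr_left fun t => by
      rw [he]; ring
  have h2 : (fun t : ℝ => h t - e₁ * t) =O[𝓝 0] (fun t : ℝ => t ^ 2) :=
    ((((h5.trans (isBigO_pow_pow (by norm_num))).add (O e₂ 2 2 le_rfl)).add
      (O e₃ 3 2 (by norm_num))).add (O e₄ 4 2 (by norm_num))).congr_left fun t => by ring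
  exact ⟨h5, h2, ((h2.trans (isBigO_pow_pow (n := 1) (by norm_num))).add
    (O e₁ 1 1 le_rfl)).congr (fun t => by ring) fun t => pow_one t⟩

section Normalization

variable {f g : ℂ × ℂ → ℂ} {c d : ℕ → ℕ → ℂ} {F G : ℂ × ℝ → ℝ} {a : ℂ}

lemma tendsto_weightedCurve (ζ : ℂ) (s : ℝ) :
    Filter.Tendsto (fun t : ℝ => ((t : ℂ) * ζ, t ^ 2 * s)) (𝓝 0) (𝓝 0) := by
  have : Continuous fun t : ℝ => ((t : ℂ) * ζ, t ^ 2 * s) := by fun_prop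
  simpa [Prod.zero_eq_mk] using this.tendsto 0

/-- The image lies in `Im w' = |z'|² + O(6)`, so `Im g` is `O(t²)` along every curve `t ↦ (tζ, 0)`
lifted to the hypersurface. Hence `d 1 0 * ζ` is real for all complex `ζ`: the complex tangent line
is preserved. -/
lemma linear_coeff_eq_zero
    (hf : (fun q => f q - weightedPoly c q) =O[𝓝 0] fun q => ‖q.1‖ ^ 6 + ‖q.2‖ ^ 3)
    (hg : (fun q => g q - weightedPoly d q) =O[𝓝 0] fun q => ‖q.1‖ ^ 6 + ‖q.2‖ ^ 3)
    (hc : c 0 0 = 0) (hd : d 0 0 = 0)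
    (hF : IsWeightedO6 fun m => F m - modelFive a m.1)
    (hG : IsWeightedO6 fun m => G m - normSq m.1)
    (hmap : ∀ᶠ m in 𝓝 (0 : ℂ × ℝ),
      (g (graphPoint F m)).im = G (f (graphPoint F m), (g (graphPoint F m)).re)) :
    d 1 0 = 0 := by
  have key : ∀ ζ : ℂ, (d 1 0 * ζ).im = 0 := by
    intro ζ
    have hw := isBigO_weightedCurve hF ζ 0
    have hfq := isBigO_comp_weightedCurve hf (ζ := ζ) hw
    have hgq := isBigO_comp_weightedCurve hg (ζ := ζ) hw
    set q : ℝ → ℂ × ℂ := fun t => ((t : ℂ) * ζ, ((t ^ 2 * 0 : ℝ) : ℂ) +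
      I * (F ((t : ℂ) * ζ, t ^ 2 * 0) : ℂ)) with hq
    obtain ⟨-, -, hf1⟩ := truncations_of_expansion (h := fun t => f (q t)) hc hfq
    obtain ⟨-, hg2, hg1⟩ := truncations_of_expansion (h := fun t => g (q t)) hd hgq
    have h1 := (isBigO_weighted_comp hG one_ne_zero (by norm_num) hf1
      (hg1.congr_right fun t => (pow_one t).symm)).trans
      (isBigO_pow_pow (n := 2) (by norm_num))
    have h2 : (fun t => normSq (f (q t))) =O[𝓝 0] fun t : ℝ => t ^ 2 :=
      (hf1.norm_left.pow 2).congr_left fun t => (normSq_eq_norm_sq _).symm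
    have h3 : (fun t => (g (q t) - d 1 0 * ζ * t).im) =O[𝓝 0] fun t : ℝ => t ^ 2 :=
      (IsBigO.of_bound 1 (.of_forall fun t => by
        rw [one_mul]; exact Complex.abs_im_le_norm _)).trans hg2
    have h4 := ((h1.add h2).sub h3).mono (nhdsWithin_le_nhds (s := {0}ᶜ))
    refine coeff_eq_zero_of_isBigO (n := 2) (c := fun k => match k with
      | 1 => (d 1 0 * ζ).im
      | _ => 0) (h4.congr' ?_ .rfl) 1 (by norm_num)
    filter_upwards [nhdsWithin_le_nhds ((tendsto_weightedCurve ζ 0).eventually hmap)] with t ht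
    have ht' : (g (q t)).im = G (f (q t), (g (q t)).re) := ht
    rw [← ht']
    simp [Finset.sum_range_succ]
  have h1 := key 1
  have h2 := key I
  refine Complex.ext ?_ ?_
  · simpa using h2
  · simpa using h1

lemma weighted_equations
    (hf : (fun q => f q - weightedPoly c q) =O[𝓝 0] fun q => ‖q.1‖ ^ 6 + ‖q.2‖ ^ 3)
    (hg : (fun q => g q - weightedPoly d q) =O[𝓝 0] fun q => ‖q.1‖ ^ 6 + ‖q.2‖ ^ 3)
    (hc : c 0 0 = 0) (hd : d 0 0 = 0)
    (hF : IsWeightedO6 fun m => F m - modelFive a m.1)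
    (hG : IsWeightedO6 fun m => G m - normSq m.1)
    (hmap : ∀ᶠ m in 𝓝 (0 : ℂ × ℝ),
      (g (graphPoint F m)).im = G (f (graphPoint F m), (g (graphPoint F m)).re))
    (ζ : ℂ) (s : ℝ) {ω : ℂ} (hω : ω = s + I * normSq ζ) :
    (d 2 0 * ζ ^ 2 + d 0 1 * ω).im = normSq (c 1 0 * ζ) ∧
    (d 3 0 * ζ ^ 3 + d 1 1 * ζ * ω).im =
      2 * (c 1 0 * ζ * conj (c 2 0 * ζ ^ 2 + c 0 1 * ω)).re ∧
    (d 4 0 * ζ ^ 4 + d 2 1 * ζ ^ 2 * ω + d 0 2 * ω ^ 2).im =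
      2 * (c 1 0 * ζ * conj (c 3 0 * ζ ^ 3 + c 1 1 * ζ * ω)).re
        + normSq (c 2 0 * ζ ^ 2 + c 0 1 * ω) ∧
    (d 5 0 * ζ ^ 5 + d 3 1 * ζ ^ 3 * ω + d 1 2 * ζ * ω ^ 2
        + d 0 1 * (I * (2 * (a * ζ ^ 3 * conj ζ ^ 2).re : ℝ))).im =
      2 * (c 1 0 * ζ * conj (c 4 0 * ζ ^ 4 + c 2 1 * ζ ^ 2 * ω + c 0 2 * ω ^ 2)).re
        + 2 * ((c 2 0 * ζ ^ 2 + c 0 1 * ω) * conj (c 3 0 * ζ ^ 3 + c 1 1 * ζ * ω)).re := by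
  have hd1 := linear_coeff_eq_zero hf hg hc hd hF hG hmap
  have hw := isBigO_weightedCurve hF ζ s
  rw [← hω] at hw
  have hfq := isBigO_comp_weightedCurve hf (ζ := ζ) hw
  have hgq := isBigO_comp_weightedCurve hg (ζ := ζ) hw
  set q : ℝ → ℂ × ℂ := fun t => ((t : ℂ) * ζ, ((t ^ 2 * s : ℝ) : ℂ) +
    I * (F ((t : ℂ) * ζ, t ^ 2 * s) : ℂ)) with hq
  obtain ⟨hf5, -, hf1⟩ := truncations_of_expansion (h := fun t => f (q t)) hc hfq
  obtain ⟨-, hg2, -⟩ := truncations_of_expansion (h := fun t => g (q t)) hd hgq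
  simp only [hd1, zero_mul, sub_zero] at hg2
  refine coeff_equations (f := fun t => f (q t)) (g := fun t => g (q t)) (r₁ := 0)
    hf5 (hgq.congr_left fun t => ?_) ?_
  · rw [hd, hd1]
    ring
  · refine (isBigO_weighted_comp hG two_ne_zero le_rfl hf1 hg2).congr' ?_ .rfl
    filter_upwards [(tendsto_weightedCurve ζ s).eventually hmap] with t ht
    have ht' : (g (q t)).im = G (f (q t), (g (q t)).re) := ht
    rw [← ht']

end Normalization

lemma re_mul_mul_conj_mul (l x y : ℂ) : (l * x * conj (l * y)).re = normSq l * (x * conj y).re := by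
  simp only [map_mul, normSq_apply, mul_re, mul_im, conj_re, conj_im]
  ring

section Normalization

variable {f g : ℂ × ℂ → ℂ} {c d : ℕ → ℕ → ℂ} {F G : ℂ × ℝ → ℝ} {a : ℂ}

/-- The weight-two identity forces `d 0 1 = |c 1 0|²`. Each higher identity is then homogeneous
under division of `f` by `c 1 0` and of `g` by `|c 1 0|²`, which reduces to `weight_five_coeff`. -/
lemma exists_normalized_coeffs
    (hf : (fun q => f q - weightedPoly c q) =O[𝓝 0] fun q => ‖q.1‖ ^ 6 + ‖q.2‖ ^ 3)
    (hg : (fun q => g q - weightedPoly d q) =O[𝓝 0] fun q => ‖q.1‖ ^ 6 + ‖q.2‖ ^ 3)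
    (hc : c 0 0 = 0) (hd : d 0 0 = 0) (hc1 : c 1 0 ≠ 0)
    (hF : IsWeightedO6 fun m => F m - modelFive a m.1)
    (hG : IsWeightedO6 fun m => G m - normSq m.1)
    (hmap : ∀ᶠ m in 𝓝 (0 : ℂ × ℝ),
      (g (graphPoint F m)).im = G (f (graphPoint F m), (g (graphPoint F m)).re)) :
    ∃ B K T : ℂ, c 0 1 = c 1 0 * B ∧ c 0 2 = c 1 0 * K ∧ d 0 1 = normSq (c 1 0) ∧
      d 0 2 = normSq (c 1 0) * T ∧ a = -4 * conj (K - B * (T.re + I * normSq B)) := by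
  have heq := fun ζ s => weighted_equations hf hg hc hd hF hG hmap ζ s rfl
  have hL : normSq (c 1 0) ≠ 0 := by simpa using hc1
  have hL' : (normSq (c 1 0) : ℂ) ≠ 0 := ofReal_ne_zero.2 hL
  have hd01 : d 0 1 = normSq (c 1 0) := by
    have h1 := (heq 0 1).1
    have h2 := (heq 1 0).1
    have h3 := (heq I 0).1
    simp only [pow_two, normSq_mul, normSq_zero, normSq_I, normSq_one, add_im, mul_im, mul_re,
      ofReal_re, ofReal_im, I_re, I_im, add_re, zero_re, zero_im, one_re, one_im] at h1 h2 h3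
    ring_nf at h1 h2 h3
    refine Complex.ext ?_ ?_
    · rw [ofReal_re]; linarith
    · rw [ofReal_im]; linarith
  have hmul : ∀ x : ℂ, x = c 1 0 * (x / c 1 0) := fun x => by field_simp
  have hmul' : ∀ x : ℂ, x = normSq (c 1 0) * (x / normSq (c 1 0)) := fun x => by field_simp
  refine ⟨_, _, _, hmul (c 0 1), hmul (c 0 2), hd01, hmul' (d 0 2), ?_⟩
  refine weight_five_coeff (P := d 3 0 / normSq (c 1 0)) (Q := d 1 1 / normSq (c 1 0))
    (R := d 4 0 / normSq (c 1 0)) (S := d 2 1 / normSq (c 1 0)) (V := d 5 0 / normSq (c 1 0))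
    (W := d 3 1 / normSq (c 1 0)) (Y := d 1 2 / normSq (c 1 0)) (A := c 2 0 / c 1 0)
    (C := c 3 0 / c 1 0) (D := c 1 1 / c 1 0) (E := c 4 0 / c 1 0) (H := c 2 1 / c 1 0)
    (fun ζ s => ?_) (fun ζ s => ?_) (fun ζ s => ?_)
  · have h := (heq ζ s).2.1
    generalize (s : ℂ) + I * normSq ζ = ω at h ⊢
    have e1 : d 3 0 * ζ ^ 3 + d 1 1 * ζ * ω = normSq (c 1 0) *
      (d 3 0 / normSq (c 1 0) * ζ ^ 3 + d 1 1 / normSq (c 1 0) * ζ * ω) := by field_simp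
    have e2 : c 2 0 * ζ ^ 2 + c 0 1 * ω = c 1 0 * (c 2 0 / c 1 0 * ζ ^ 2 + c 0 1 / c 1 0 * ω) := by
      field_simp
    rw [e1, e2, im_ofReal_mul, re_mul_mul_conj_mul] at h
    refine mul_left_cancel₀ hL ?_
    rw [h]
    ring
  · have h := (heq ζ s).2.2.1
    generalize (s : ℂ) + I * normSq ζ = ω at h ⊢
    have e1 : d 4 0 * ζ ^ 4 + d 2 1 * ζ ^ 2 * ω + d 0 2 * ω ^ 2 = normSq (c 1 0) *
      (d 4 0 / normSq (c 1 0) * ζ ^ 4 + d 2 1 / normSq (c 1 0) * ζ ^ 2 * ω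
        + d 0 2 / normSq (c 1 0) * ω ^ 2) := by field_simp
    have e2 : c 2 0 * ζ ^ 2 + c 0 1 * ω = c 1 0 * (c 2 0 / c 1 0 * ζ ^ 2 + c 0 1 / c 1 0 * ω) := by
      field_simp
    have e3 : c 3 0 * ζ ^ 3 + c 1 1 * ζ * ω =
      c 1 0 * (c 3 0 / c 1 0 * ζ ^ 3 + c 1 1 / c 1 0 * ζ * ω) := by field_simp
    rw [e1, e2, e3, im_ofReal_mul, re_mul_mul_conj_mul, normSq_mul] at h
    refine mul_left_cancel₀ hL ?_
    rw [h]
    ring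
  · have h := (heq ζ s).2.2.2
    generalize (s : ℂ) + I * normSq ζ = ω at h ⊢
    have e1 : d 5 0 * ζ ^ 5 + d 3 1 * ζ ^ 3 * ω + d 1 2 * ζ * ω ^ 2
        + d 0 1 * (I * (2 * (a * ζ ^ 3 * conj ζ ^ 2).re : ℝ)) = normSq (c 1 0) *
      (d 5 0 / normSq (c 1 0) * ζ ^ 5 + d 3 1 / normSq (c 1 0) * ζ ^ 3 * ω
        + d 1 2 / normSq (c 1 0) * ζ * ω ^ 2 + I * (2 * (a * ζ ^ 3 * conj ζ ^ 2).re : ℝ)) := by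
      rw [hd01]
      field_simp
    have e2 : c 2 0 * ζ ^ 2 + c 0 1 * ω = c 1 0 * (c 2 0 / c 1 0 * ζ ^ 2 + c 0 1 / c 1 0 * ω) := by
      field_simp
    have e3 : c 3 0 * ζ ^ 3 + c 1 1 * ζ * ω =
      c 1 0 * (c 3 0 / c 1 0 * ζ ^ 3 + c 1 1 / c 1 0 * ζ * ω) := by field_simp
    have e4 : c 4 0 * ζ ^ 4 + c 2 1 * ζ ^ 2 * ω + c 0 2 * ω ^ 2 = c 1 0 *
      (c 4 0 / c 1 0 * ζ ^ 4 + c 2 1 / c 1 0 * ζ ^ 2 * ω + c 0 2 / c 1 0 * ω ^ 2) := by field_simp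
    rw [e1, e2, e3, e4, im_ofReal_mul, re_mul_mul_conj_mul, re_mul_mul_conj_mul, add_im,
      im_mul_ofReal, I_im, one_mul] at h
    refine mul_left_cancel₀ hL ?_
    rw [h]
    ring

/-! ### The image of the axis and the chain condition -/

lemma eq_weightedPoly_zero
    (hf : (fun q => f q - weightedPoly c q) =O[𝓝 0] fun q => ‖q.1‖ ^ 6 + ‖q.2‖ ^ 3) :
    f 0 = c 0 0 := by
  obtain ⟨C, hC⟩ := hf.bound
  have := hC.self_of_nhds
  simpa [weightedPoly, sub_eq_zero] using this

/-- Links `c 1 0` to the differential of the map, whose invertibility then makes it nonzero. -/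
lemma hasDerivAt_fst_of_weighted
    (hf : (fun q => f q - weightedPoly c q) =O[𝓝 0] fun q => ‖q.1‖ ^ 6 + ‖q.2‖ ^ 3) :
    HasDerivAt (fun z : ℂ => f (z, 0)) (c 1 0) 0 := by
  have htend : Filter.Tendsto (fun z : ℂ => (z, (0 : ℂ))) (𝓝 0) (𝓝 0) := by
    have : Continuous fun z : ℂ => (z, (0 : ℂ)) := by fun_prop
    exact this.tendsto 0
  have h1 : (fun z : ℂ => f (z, 0) - weightedPoly c (z, 0)) =o[𝓝 0] fun z : ℂ => z := by
    refine ((hf.comp_tendsto htend).congr_right (g₂ := fun z : ℂ => ‖z ^ 6‖) fun z => by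
      simp).of_norm_right.trans_isLittleO ?_
    exact isLittleO_pow_id (by norm_num)
  have h2 : HasDerivAt (fun z : ℂ => f (z, 0) - weightedPoly c (z, 0)) 0 0 := by
    rw [hasDerivAt_iff_isLittleO]
    simpa [eq_weightedPoly_zero hf, ← Prod.zero_eq_mk, weightedPoly] using h1
  have h3 : HasDerivAt (fun z : ℂ => weightedPoly c (z, 0)) (c 1 0) 0 := by
    have h4 : HasDerivAt (fun z : ℂ => c 0 0 + c 1 0 * z + c 2 0 * z ^ 2 + c 3 0 * z ^ 3
        + c 4 0 * z ^ 4 + c 5 0 * z ^ 5) (c 1 0) 0 := by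
      have := (((((((hasDerivAt_id (0 : ℂ)).const_mul (c 1 0)).const_add (c 0 0)).fun_add
        ((hasDerivAt_pow 2 (0 : ℂ)).const_mul (c 2 0))).fun_add
        ((hasDerivAt_pow 3 (0 : ℂ)).const_mul (c 3 0))).fun_add
        ((hasDerivAt_pow 4 (0 : ℂ)).const_mul (c 4 0))).fun_add
        ((hasDerivAt_pow 5 (0 : ℂ)).const_mul (c 5 0)))
      simpa using this
    refine h4.congr_of_eventuallyEq (.of_forall fun z => ?_)
    simp [weightedPoly]
  simpa using h2.fun_add h3

lemma isBigO_axis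
    (hf : (fun q => f q - weightedPoly c q) =O[𝓝 0] fun q => ‖q.1‖ ^ 6 + ‖q.2‖ ^ 3)
    (hc : c 0 0 = 0) :
    (fun t : ℝ => f (0, t) - (c 0 1 * t + c 0 2 * t ^ 2)) =O[𝓝 0] fun t : ℝ => t ^ 3 := by
  have htend : Filter.Tendsto (fun t : ℝ => ((0 : ℂ), (t : ℂ))) (𝓝 0) (𝓝 0) := by
    have : Continuous fun t : ℝ => ((0 : ℂ), (t : ℂ)) := by fun_prop
    simpa [Prod.zero_eq_mk] using this.tendsto 0
  refine ((hf.comp_tendsto htend).congr (f₂ := fun t : ℝ => f (0, t) - (c 0 1 * t + c 0 2 * t ^ 2))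
    (g₂ := fun t : ℝ => ‖t ^ 3‖) (fun t => ?_) fun t => ?_).of_norm_right
  · simp [weightedPoly, hc]
  · simp

end Normalization

lemma deriv_eq_of_isBigO {h : ℝ → ℝ} (hh : AnalyticAt ℝ h 0) {b k : ℝ}
    (H : (fun t => h t - (b * t + k * t ^ 2)) =O[𝓝 0] fun t => t ^ 3) :
    deriv h 0 = b ∧ deriv (deriv h) 0 = 2 * k := by
  have h1 := hh.hasFPowerSeriesAt.isBigO_sub_partialSum_pow 3
  have h2 : (fun t => h t - (h 0 + deriv h 0 * t + deriv (deriv h) 0 / 2 * t ^ 2)) =O[𝓝 0]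
      fun t => t ^ 3 := by
    refine (h1.congr (g₂ := fun t => ‖t ^ 3‖) (fun t => ?_) fun t => ?_).of_norm_right
    · simp [FormalMultilinearSeries.partialSum, Finset.sum_range_succ,
        FormalMultilinearSeries.ofScalars, iteratedDeriv_succ, iteratedDeriv_zero]
    · simp
  have h3 := coeff_eq_zero_of_isBigO (n := 3) (c := fun n => match n with
    | 0 => h 0
    | 1 => deriv h 0 - b
    | 2 => deriv (deriv h) 0 / 2 - k
    | _ => 0) (((H.sub h2).mono nhdsWithin_le_nhds).congr_left fun t => by
      simp only [Finset.sum_range_succ, Finset.sum_range_zero]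
      ring)
  have h4 : deriv h 0 - b = 0 := h3 1 (by norm_num)
  have h5 : deriv (deriv h) 0 / 2 - k = 0 := h3 2 (by norm_num)
  constructor <;> linarith

lemma analyticAt_re_axis {f : ℂ × ℂ → ℂ} (hf : AnalyticAt ℂ f 0) :
    AnalyticAt ℝ (fun t : ℝ => (f (0, t)).re) 0 ∧ AnalyticAt ℝ (fun t : ℝ => (f (0, t)).im) 0 := by
  have h1 : AnalyticAt ℝ (fun t : ℝ => ((0 : ℂ), (t : ℂ))) 0 :=
    analyticAt_const.prod (ofRealCLM.analyticAt 0)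
  have h2 : AnalyticAt ℝ (fun t : ℝ => f (0, t)) 0 :=
    AnalyticAt.fun_comp (g := f) (by simpa [← Prod.zero_eq_mk] using hf.restrictScalars) h1
  exact ⟨(reCLM.analyticAt _).fun_comp h2, (imCLM.analyticAt _).fun_comp h2⟩

lemma isBigO_re_im_axis {f : ℂ × ℂ → ℂ} {b k : ℂ}
    (H : (fun t : ℝ => f (0, t) - (b * t + k * t ^ 2)) =O[𝓝 0] fun t : ℝ => t ^ 3) :
    (fun t : ℝ => (f (0, t)).re - (b.re * t + k.re * t ^ 2)) =O[𝓝 0] (fun t : ℝ => t ^ 3) ∧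
    (fun t : ℝ => (f (0, t)).im - (b.im * t + k.im * t ^ 2)) =O[𝓝 0] fun t : ℝ => t ^ 3 := by
  constructor
  · refine (IsBigO.of_bound 1 (.of_forall fun t => ?_)).trans H
    have : (f (0, t)).re - (b.re * t + k.re * t ^ 2) = (f (0, t) - (b * t + k * t ^ 2)).re := by
      simp [← ofReal_pow]
    rw [this, one_mul]
    exact Complex.abs_re_le_norm _
  · refine (IsBigO.of_bound 1 (.of_forall fun t => ?_)).trans H
    have : (f (0, t)).im - (b.im * t + k.im * t ^ 2) = (f (0, t) - (b * t + k * t ^ 2)).im := by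
      simp [← ofReal_pow]
    rw [this, one_mul]
    exact Complex.abs_im_le_norm _

/-- A jet with first and second derivatives `b`, `2k` (for `z`) and `L`, `2r` (for `u`) which lies
in `Σ₀`. -/
lemma eq_of_mem_sigmaZero {b k : ℂ} {L r : ℝ} (hL : L ≠ 0)
    (h : (⟨b.re / L, b.im / L, (2 * k.re * L - b.re * (2 * r)) / L ^ 3,
      (2 * k.im * L - b.im * (2 * r)) / L ^ 3⟩ : Jet2) ∈ sigmaZero) :
    k * L = b * (r + I * normSq b) := by
  -- In complex form `Σ₀` reads `z₂ = 2i |z₁|² z₁`, here with `z₁ = b / L` and `z₂ = 2 (k L - b r) /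
  -- L³`.
  obtain ⟨h1, h2⟩ := h
  simp only at h1 h2
  field_simp at h1 h2
  refine Complex.ext ?_ ?_
  · simp only [mul_re, mul_im, add_re, add_im, ofReal_re, ofReal_im, I_re, I_im, normSq_apply]
    linarith
  · simp only [mul_re, mul_im, add_re, add_im, ofReal_re, ofReal_im, I_re, I_im, normSq_apply]
    linarith

/-- The coefficient identity evaluates `a` by the defect `K - B (Re T + i|B|²)`, and membership of
the image jet in `Σ₀` is the vanishing of this defect. -/
lemma eq_zero_of_mem_chainLocus {D : Set (ℂ × ℝ)} (hD : IsOpen D) {F : ℂ × ℝ → ℝ} {u₀ : ℝ}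
    (hu₀ : ((0 : ℂ), u₀) ∈ D) (hcont : ContinuousAt F (0, u₀))
    (hF0 : ∀ᶠ u in 𝓝 u₀, F (0, u) = 0)
    (hj : (⟨0, 0, 0, 0⟩ : Jet2) ∈ chainLocus D F (0, u₀)) {a : ℂ}
    (hF : IsWeightedO6 fun m => F (m.1, u₀ + m.2) - modelFive a m.1) : a = 0 := by
  obtain ⟨φ, hφ, -, hjet₀⟩ := hj
  have hp : graphPoint F (0, u₀) = (0, (u₀ : ℂ)) := by simp [graphPoint, hF0.self_of_nhds]
  rw [hp] at hφ
  obtain ⟨hφa, hφ0, hφi, G, -, hG, hM⟩ := hφ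
  set τ : ℂ × ℂ → ℂ × ℂ := fun q => (q.1, u₀ + q.2) with hτ
  have hτ0 : τ 0 = (0, (u₀ : ℂ)) := by simp [hτ]
  have hτa : AnalyticAt ℂ τ 0 := analyticAt_fst.prod (analyticAt_const.add analyticAt_snd)
  have hψ : AnalyticAt ℂ (fun q => φ (τ q)) 0 := AnalyticAt.fun_comp (by rwa [hτ0]) hτa
  set f : ℂ × ℂ → ℂ := fun q => (φ (τ q)).1 with hf_def
  set g : ℂ × ℂ → ℂ := fun q => (φ (τ q)).2 with hg_def
  have hfa : AnalyticAt ℂ f 0 := analyticAt_fst.fun_comp hψ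
  have hga : AnalyticAt ℂ g 0 := analyticAt_snd.fun_comp hψ
  obtain ⟨c, hf⟩ := exists_weightedPoly hfa
  obtain ⟨d, hg⟩ := exists_weightedPoly hga
  have hc : c 0 0 = 0 := by
    rw [← eq_weightedPoly_zero hf]; simp [hf_def, hτ0, hφ0]
  have hd : d 0 0 = 0 := by
    rw [← eq_weightedPoly_zero hg]; simp [hg_def, hτ0, hφ0]
  have hmap : ∀ᶠ m in 𝓝 (0 : ℂ × ℝ), (g (graphPoint (fun m => F (m.1, u₀ + m.2)) m)).im =
      G (f (graphPoint (fun m => F (m.1, u₀ + m.2)) m),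
        (g (graphPoint (fun m => F (m.1, u₀ + m.2)) m)).re) := by
    have hshift : Filter.Tendsto (fun m : ℂ × ℝ => (m.1, u₀ + m.2)) (𝓝 0) (𝓝 (0, u₀)) := by
      have : Continuous fun m : ℂ × ℝ => (m.1, u₀ + m.2) := by fun_prop
      simpa using this.tendsto 0
    have hgr : Filter.Tendsto (graphPoint F) (𝓝 (0, u₀)) (𝓝 (0, (u₀ : ℂ))) := by
      rw [← hp]
      have : ContinuousAt (graphPoint F) (0, u₀) := by
        unfold graphPoint
        fun_prop
      exact this
    filter_upwards [(hgr.comp hshift).eventually hM,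
      hshift.eventually (hD.mem_nhds hu₀)] with m hm hmD
    have e : τ (graphPoint (fun m => F (m.1, u₀ + m.2)) m) = graphPoint F (m.1, u₀ + m.2) := by
      simp [hτ, graphPoint, add_assoc]
    simp only [hf_def, hg_def, e]
    refine hm.1 ⟨?_, ?_⟩
    · have hmD' : (m.1, u₀ + m.2) ∈ D := hmD
      simpa [graphPoint] using hmD'
    · simp [graphPoint]
  have hd1 := linear_coeff_eq_zero hf hg hc hd hF hG hmap
  -- Otherwise, as `d 1 0 = 0`, the differential of `φ` would kill `(1, 0)`.
  have hc1 : c 1 0 ≠ 0 := by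
    intro hc1
    have h1 : HasDerivAt (fun z : ℂ => φ (z, u₀)) (fderiv ℂ φ (0, (u₀ : ℂ)) (1, 0)) 0 := by
      have : HasDerivAt (fun z : ℂ => (z, (u₀ : ℂ))) (1, 0) 0 :=
        (hasDerivAt_id 0).prodMk (hasDerivAt_const _ _)
      exact hφa.differentiableAt.hasFDerivAt.comp_hasDerivAt (0 : ℂ) this
    have h2 : HasDerivAt (fun z : ℂ => φ (z, u₀)) (c 1 0, d 1 0) 0 := by
      refine ((hasDerivAt_fst_of_weighted hf).prodMk
        (hasDerivAt_fst_of_weighted hg)).congr_of_eventuallyEq (.of_forall fun z => ?_)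
      simp [hf_def, hg_def, hτ]
    have h3 := h1.unique h2
    rw [hc1, hd1] at h3
    have h4 := hφi.injective (h3.trans (map_zero _).symm)
    simp [Prod.ext_iff] at h4
  obtain ⟨B, K, T, hB, hK, hL, hT, ha⟩ := exists_normalized_coeffs hf hg hc hd hc1 hF hG hmap
  -- As `F` vanishes on the axis, the representative of the zero jet is the axis itself, so the
  -- derivatives of its image are read off `c 0 1`, `c 0 2`, `d 0 1`, `d 0 2`.
  have hrep : ∀ᶠ t in 𝓝 (0 : ℝ), representative F (0, u₀) ⟨0, 0, 0, 0⟩ t = τ (0, t) := by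
    have : Filter.Tendsto (fun t : ℝ => u₀ + t) (𝓝 0) (𝓝 u₀) := by
      have : Continuous fun t : ℝ => u₀ + t := by fun_prop
      simpa using this.tendsto 0
    filter_upwards [this.eventually hF0] with t ht
    simp [representative, graphPoint, hτ, ht]
  have eX : (fun t => (φ (representative F (0, u₀) ⟨0, 0, 0, 0⟩ t)).1.re) =ᶠ[𝓝 0]
      fun t : ℝ => (f (0, t)).re := hrep.mono fun t ht => by simp only [ht, hf_def]
  have eY : (fun t => (φ (representative F (0, u₀) ⟨0, 0, 0, 0⟩ t)).1.im) =ᶠ[𝓝 0]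
      fun t : ℝ => (f (0, t)).im := hrep.mono fun t ht => by simp only [ht, hf_def]
  have eU : imageU φ F (0, u₀) ⟨0, 0, 0, 0⟩ =ᶠ[𝓝 0]
      fun t : ℝ => (g (0, t)).re := hrep.mono fun t ht => by simp only [imageU, ht, hg_def]
  obtain ⟨X1, X2⟩ := deriv_eq_of_isBigO (analyticAt_re_axis hfa).1
    (isBigO_re_im_axis (isBigO_axis hf hc)).1
  obtain ⟨Y1, Y2⟩ := deriv_eq_of_isBigO (analyticAt_re_axis hfa).2
    (isBigO_re_im_axis (isBigO_axis hf hc)).2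
  obtain ⟨U1, U2⟩ := deriv_eq_of_isBigO (analyticAt_re_axis hga).1
    (isBigO_re_im_axis (isBigO_axis hg hd)).1
  have hL0 : normSq (c 1 0) ≠ 0 := by simpa using hc1
  rw [hL, ofReal_re] at U1
  have hjet := eq_of_mem_sigmaZero (b := c 0 1) (k := c 0 2) (r := (d 0 2).re) hL0 (by
    have := hjet₀
    simp only [prolong2, jetOfCurve, eX.deriv_eq, eY.deriv_eq, eU.deriv_eq, eX.deriv.deriv_eq,
      eY.deriv.deriv_eq, eU.deriv.deriv_eq, X1, X2, Y1, Y2, U1, U2] at this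
    exact this)
  rw [hK, hB, hT, re_ofReal_mul, normSq_mul] at hjet
  have hK' : K - B * (T.re + I * normSq B) = 0 := by
    have h1 : (normSq (c 1 0) : ℂ) ≠ 0 := ofReal_ne_zero.2 hL0
    refine (mul_eq_zero.1 (?_ : (c 1 0 * normSq (c 1 0)) * _ = 0)).resolve_left
      (mul_ne_zero hc1 h1)
    push_cast at hjet
    linear_combination hjet
  rw [ha, hK', map_zero, mul_zero]

/-! ### Wirtinger derivatives and Taylor's formula in `z` -/

section Wirtinger

variable {D : Set (ℂ × ℝ)} {H H₁ H₂ : ℂ × ℝ → ℂ}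

lemma analyticOnNhd_fderiv_apply (hH : AnalyticOnNhd ℝ H D) (v : ℂ × ℝ) :
    AnalyticOnNhd ℝ (fun m => fderiv ℝ H m v) D := fun m hm =>
  ((ContinuousLinearMap.apply ℝ ℂ v).analyticAt _).fun_comp (hH.fderiv m hm)

lemma analyticOnNhd_dz (hH : AnalyticOnNhd ℝ H D) : AnalyticOnNhd ℝ (dz H) D := fun m hm =>
  analyticAt_const.mul ((analyticOnNhd_fderiv_apply hH _ m hm).sub
    (analyticAt_const.mul (analyticOnNhd_fderiv_apply hH _ m hm)))

lemma analyticOnNhd_dzbar (hH : AnalyticOnNhd ℝ H D) : AnalyticOnNhd ℝ (dzbar H) D := fun m hm =>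
  analyticAt_const.mul ((analyticOnNhd_fderiv_apply hH _ m hm).add
    (analyticAt_const.mul (analyticOnNhd_fderiv_apply hH _ m hm)))

lemma analyticOnNhd_dz_iterate (hH : AnalyticOnNhd ℝ H D) (n : ℕ) :
    AnalyticOnNhd ℝ (dz^[n] H) D := by
  induction n with
  | zero => exact hH
  | succ n ih => rw [Function.iterate_succ_apply']; exact analyticOnNhd_dz ih

lemma analyticOnNhd_dzbar_iterate (hH : AnalyticOnNhd ℝ H D) (n : ℕ) :
    AnalyticOnNhd ℝ (dzbar^[n] H) D := by
  induction n with
  | zero => exact hH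
  | succ n ih => rw [Function.iterate_succ_apply']; exact analyticOnNhd_dzbar ih

lemma dzbar_congr (hD : IsOpen D) (h : Set.EqOn H₁ H₂ D) : Set.EqOn (dzbar H₁) (dzbar H₂) D := by
  intro m hm
  have : H₁ =ᶠ[𝓝 m] H₂ := Filter.eventuallyEq_of_mem (hD.mem_nhds hm) h
  simp only [dzbar, this.fderiv_eq]

lemma dz_dzbar_comm (hH : AnalyticOnNhd ℝ H D) : Set.EqOn (dz (dzbar H)) (dzbar (dz H)) D := by
  intro m hm
  have hsymm : IsSymmSndFDerivAt ℝ H m := 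
    ((hH m hm).contDiffAt (n := 2)).isSymmSndFDerivAt (by simp)
  have hd : DifferentiableAt ℝ (fderiv ℝ H) m := (hH.fderiv m hm).differentiableAt
  have hdv : ∀ v : ℂ × ℝ, HasFDerivAt (fun m => fderiv ℝ H m v)
      ((fderiv ℝ (fderiv ℝ H) m).flip v) m := fun v => by
    simpa using hd.hasFDerivAt.clm_apply (hasFDerivAt_const v m)
  have e1 : HasFDerivAt (dzbar H) ((1 / 2 : ℂ) • ((fderiv ℝ (fderiv ℝ H) m).flip (1, 0) +
      I • (fderiv ℝ (fderiv ℝ H) m).flip (I, 0))) m :=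
    ((hdv _).fun_add ((hdv _).const_mul I)).const_mul _
  have e2 : HasFDerivAt (dz H) ((1 / 2 : ℂ) • ((fderiv ℝ (fderiv ℝ H) m).flip (1, 0) -
      I • (fderiv ℝ (fderiv ℝ H) m).flip (I, 0))) m :=
    ((hdv _).fun_sub ((hdv _).const_mul I)).const_mul _
  rw [dz, dzbar, e1.fderiv, e2.fderiv]
  simp only [smul_apply, add_apply,
    sub_apply, ContinuousLinearMap.flip_apply, smul_eq_mul]
  rw [hsymm.eq (I, 0) (1, 0)]
  ring

lemma dz_dzbar_iterate_comm (hD : IsOpen D) (hH : AnalyticOnNhd ℝ H D) (k : ℕ) :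
    Set.EqOn (dz (dzbar^[k] H)) (dzbar^[k] (dz H)) D := by
  induction k with
  | zero => exact fun _ _ => rfl
  | succ k ih =>
    rw [Function.iterate_succ_apply', Function.iterate_succ_apply']
    exact (dz_dzbar_comm (analyticOnNhd_dzbar_iterate hH k)).trans (dzbar_congr hD ih)

lemma fderiv_apply_eq_wirtinger (H : ℂ × ℝ → ℂ) (m : ℂ × ℝ) (z : ℂ) :
    fderiv ℝ H m (z, 0) = z * dz H m + conj z * dzbar H m := by
  have : ((z, 0) : ℂ × ℝ) = z.re • (1, 0) + z.im • (I, 0) := by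
    ext <;> simp
  have hz : (z.re : ℂ) + z.im * I = z := re_add_im z
  have hz' : conj z = z.re - z.im * I := by apply Complex.ext <;> simp
  rw [this, map_add, map_smul, map_smul, hz', dz, dzbar]
  conv_rhs => rw [← hz]
  simp only [real_smul]
  simp only [add_re, ofReal_re, mul_re, I_re, mul_zero, ofReal_im, I_im, mul_one, sub_self,
    add_zero, add_im, mul_im, zero_add]
  linear_combination ((z.im : ℂ) * fderiv ℝ H m (I, 0)) * I_sq

/-- The `n`-th derivative of `H` in the direction `(z, 0)`, in terms of Wirtinger derivatives. -/
def dirDeriv (H : ℂ × ℝ → ℂ) (n : ℕ) (z : ℂ) (m : ℂ × ℝ) : ℂ :=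
  ∑ ij ∈ Finset.HasAntidiagonal.antidiagonal n,
    (n.choose ij.1 : ℂ) * (z ^ ij.1 * conj z ^ ij.2 * (dzbar^[ij.2] (dz^[ij.1] H)) m)

/-- Differentiation along the fixed vector `(z, 0)` is `z ∂_z + z̄ ∂_z̄`, whose two parts commute on
analytic functions; Pascal's rule then gives the next binomial sum. -/
lemma hasFDerivAt_dirDeriv (hD : IsOpen D) (hH : AnalyticOnNhd ℝ H D) (n : ℕ) (z : ℂ)
    {m : ℂ × ℝ} (hm : m ∈ D) :
    DifferentiableAt ℝ (dirDeriv H n z) m ∧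
      fderiv ℝ (dirDeriv H n z) m (z, 0) = dirDeriv H (n + 1) z m := by
  have hmix : ∀ i j, HasFDerivAt (dzbar^[j] (dz^[i] H)) (fderiv ℝ (dzbar^[j] (dz^[i] H)) m) m :=
    fun i j => ((analyticOnNhd_dzbar_iterate (analyticOnNhd_dz_iterate hH i) j) m
      hm).differentiableAt.hasFDerivAt
  have h : HasFDerivAt (dirDeriv H n z) (∑ ij ∈ Finset.HasAntidiagonal.antidiagonal n,
      (n.choose ij.1 : ℂ) • ((z ^ ij.1 * conj z ^ ij.2) •
        fderiv ℝ (dzbar^[ij.2] (dz^[ij.1] H)) m)) m :=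
    HasFDerivAt.fun_sum fun ij _ => ((hmix ij.1 ij.2).const_mul _).const_mul _
  refine ⟨h.differentiableAt, ?_⟩
  rw [h.fderiv, dirDeriv, Finset.sum_antidiagonal_choose_succ_mul
    (fun i j => z ^ i * conj z ^ j * (dzbar^[j] (dz^[i] H)) m) n, sum_apply,
    ← Finset.sum_add_distrib]
  refine Finset.sum_congr rfl fun ij hij => ?_
  have hc : n.choose ij.2 = n.choose ij.1 := by
    rw [← Finset.HasAntidiagonal.mem_antidiagonal.1 hij, add_comm]
    exact Nat.choose_symm_add
  rw [hc, smul_apply, smul_apply,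
    fderiv_apply_eq_wirtinger, dz_dzbar_iterate_comm hD (analyticOnNhd_dz_iterate hH _) _ hm,
    ← Function.iterate_succ_apply' dz, ← Function.iterate_succ_apply' dzbar]
  simp only [smul_eq_mul]
  ring

lemma hasDerivAt_dirDeriv (hD : IsOpen D) (hH : AnalyticOnNhd ℝ H D) (n : ℕ) (z : ℂ) (u t : ℝ)
    (hm : ((t : ℂ) * z, u) ∈ D) :
    HasDerivAt (fun t : ℝ => dirDeriv H n z ((t : ℂ) * z, u)) (dirDeriv H (n + 1) z (t * z, u))
      t := by
  obtain ⟨h1, h2⟩ := hasFDerivAt_dirDeriv hD hH n z hm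
  have h3 : HasDerivAt (fun t : ℝ => ((t : ℂ) * z, u)) (z, 0) t := by
    refine HasDerivAt.prodMk ?_ (hasDerivAt_const _ _)
    simpa using (ofRealCLM.hasDerivAt (x := t)).mul_const z
  rw [← h2]
  exact h1.hasFDerivAt.comp_hasDerivAt t h3

/-- Taylor's formula for `t ↦ H (tz, u)` on `[0, 1]`, evaluated at `t = 1`; the factor `1 / n!` in
the remainder is discarded. -/
lemma norm_sub_taylor_le (hD : IsOpen D) (hH : AnalyticOnNhd ℝ H D) (z : ℂ) (u : ℝ)
    (hm : ∀ t ∈ Set.Icc (0 : ℝ) 1, ((t : ℂ) * z, u) ∈ D) (n : ℕ) {C : ℝ}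
    (hC : ∀ t ∈ Set.Icc (0 : ℝ) 1, ‖dirDeriv H (n + 1) z (t * z, u)‖ ≤ C) :
    ‖H (z, u) - ∑ k ∈ Finset.range (n + 1), (k.factorial : ℂ)⁻¹ * dirDeriv H k z (0, u)‖ ≤ C := by
  have hit : ∀ k, ∀ t ∈ Set.Icc (0 : ℝ) 1,
      iteratedDerivWithin k (fun t : ℝ => H ((t : ℂ) * z, u)) (Set.Icc 0 1) t =
        dirDeriv H k z (t * z, u) := by
    intro k
    induction k with
    | zero => intro t _; simp [dirDeriv]
    | succ k ih =>
      intro t ht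
      rw [iteratedDerivWithin_succ, derivWithin_congr ih (ih t ht)]
      exact (hasDerivAt_dirDeriv hD hH k z u t (hm t ht)).hasDerivWithinAt.derivWithin
        (uniqueDiffOn_Icc zero_lt_one t ht)
  have hcd : ContDiffOn ℝ (n + 1) (fun t : ℝ => H ((t : ℂ) * z, u)) (Set.Icc 0 1) := by
    intro t ht
    have h1 : ContDiffAt ℝ (n + 1) H ((t : ℂ) * z, u) := (hH _ (hm t ht)).contDiffAt
    have h2 : ContDiff ℝ (n + 1) fun t : ℝ => ((t : ℂ) * z, u) :=
      (ofRealCLM.contDiff.mul contDiff_const).prodMk contDiff_const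
    exact (h1.comp t h2.contDiffAt).contDiffWithinAt
  have hC0 : 0 ≤ C := (norm_nonneg _).trans (hC 0 (by simp))
  have key := taylor_mean_remainder_bound zero_le_one hcd (Set.right_mem_Icc.2 zero_le_one)
    (fun t ht => by rw [hit _ t ht]; exact hC t ht)
  rw [taylor_within_apply] at key
  have hsum : ∑ k ∈ Finset.range (n + 1), (((k.factorial : ℝ)⁻¹ * (1 - 0) ^ k) •
      iteratedDerivWithin k (fun t : ℝ => H ((t : ℂ) * z, u)) (Set.Icc 0 1) 0) =
      ∑ k ∈ Finset.range (n + 1), (k.factorial : ℂ)⁻¹ * dirDeriv H k z (0, u) := by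
    refine Finset.sum_congr rfl fun k _ => ?_
    rw [hit k 0 (by simp)]
    simp
  rw [hsum] at key
  simp only [ofReal_one, one_mul, sub_zero, one_pow, mul_one] at key
  refine key.trans (div_le_self hC0 ?_)
  exact_mod_cast Nat.one_le_iff_ne_zero.2 (Nat.factorial_ne_zero n)

end Wirtinger

/-! ### Expansion of a prenormalized hypersurface along the axis -/

variable {D : Set (ℂ × ℝ)} {F : ℂ × ℝ → ℝ}

lemma analyticOnNhd_ofReal (hF : AnalyticOnNhd ℝ F D) :
    AnalyticOnNhd ℝ (fun m => (F m : ℂ)) D := fun m hm =>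
  (ofRealCLM.analyticAt _).fun_comp (hF m hm)

lemma analyticOnNhd_wirtinger {H : ℂ × ℝ → ℂ} (hH : AnalyticOnNhd ℝ H D) (i j : ℕ) :
    AnalyticOnNhd ℝ (dzbar^[j] (dz^[i] H)) D :=
  analyticOnNhd_dzbar_iterate (analyticOnNhd_dz_iterate hH i) j

/-- Uniformity in the direction `z` matters: in the Taylor remainder `z` is both the direction and
the source of the base point `(tz, u)`. -/
lemma eventually_norm_dirDeriv_le {H : ℂ × ℝ → ℂ} (hH : AnalyticOnNhd ℝ H D) {m₀ : ℂ × ℝ}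
    (hm₀ : m₀ ∈ D) (n : ℕ) :
    ∃ C : ℝ, ∀ᶠ m in 𝓝 m₀, ∀ z : ℂ, ‖dirDeriv H n z m‖ ≤ C * ‖z‖ ^ n := by
  have h1 : ∀ ij ∈ Finset.HasAntidiagonal.antidiagonal n, ∀ᶠ m in 𝓝 m₀,
      ‖(dzbar^[ij.2] (dz^[ij.1] H)) m‖ < ‖(dzbar^[ij.2] (dz^[ij.1] H)) m₀‖ + 1 := fun ij _ =>
    (analyticOnNhd_wirtinger hH ij.1 ij.2 m₀ hm₀).continuousAt.norm.eventually_lt_const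
      (lt_add_one _)
  refine ⟨∑ ij ∈ Finset.HasAntidiagonal.antidiagonal n,
    (n.choose ij.1 : ℝ) * (‖(dzbar^[ij.2] (dz^[ij.1] H)) m₀‖ + 1), ?_⟩
  filter_upwards [(Filter.eventually_all_finset _).2 h1] with m hm z
  rw [dirDeriv, Finset.sum_mul]
  refine (norm_sum_le _ _).trans (Finset.sum_le_sum fun ij hij => ?_)
  rw [norm_mul, norm_mul, norm_mul, norm_pow, norm_pow, RCLike.norm_conj, norm_natCast, ← pow_add,
    Finset.HasAntidiagonal.mem_antidiagonal.1 hij, mul_comm (‖z‖ ^ n), mul_assoc]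
  gcongr
  exact (hm ij hij).le

lemma inv_factorial_mul_dirDeriv (F : ℂ × ℝ → ℝ) (n : ℕ) (z : ℂ) (u : ℝ) :
    (n.factorial : ℂ)⁻¹ * dirDeriv (fun m => (F m : ℂ)) n z (0, u) =
      ∑ i ∈ Finset.range (n + 1), coeff F i (n - i) u * z ^ i * conj z ^ (n - i) := by
  rw [dirDeriv, Finset.mul_sum, ← Finset.Nat.sum_antidiagonal_eq_sum_range_succ
    (fun i j => coeff F i j u * z ^ i * conj z ^ j)]
  refine Finset.sum_congr rfl fun ij hij => ?_
  rw [← Finset.HasAntidiagonal.mem_antidiagonal.1 hij, coeff, Nat.cast_add_choose]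
  have h1 : ((ij.1 + ij.2).factorial : ℂ) ≠ 0 := by exact_mod_cast Nat.factorial_ne_zero _
  field_simp

lemma isBigO_sub_taylor (hD : IsOpen D) (hF : AnalyticOnNhd ℝ F D) {u₀ : ℝ}
    (hu₀ : ((0 : ℂ), u₀) ∈ D) (N : ℕ) :
    (fun m : ℂ × ℝ => (F (m.1, u₀ + m.2) : ℂ) - ∑ n ∈ Finset.range (N + 1),
      ∑ i ∈ Finset.range (n + 1), coeff F i (n - i) (u₀ + m.2) * m.1 ^ i * conj m.1 ^ (n - i))
      =O[𝓝 0] fun m => ‖m.1‖ ^ (N + 1) := by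
  have hH := analyticOnNhd_ofReal hF
  obtain ⟨C, hC⟩ := eventually_norm_dirDeriv_le hH hu₀ (N + 1)
  obtain ⟨r, hr, hball⟩ := Metric.eventually_nhds_iff_ball.1 (hC.and (hD.mem_nhds hu₀))
  refine IsBigO.of_bound C ?_
  filter_upwards [Metric.ball_mem_nhds (0 : ℂ × ℝ) hr] with m hm
  have hm' : ‖m.1‖ < r ∧ ‖m.2‖ < r := by
    simpa [Prod.norm_def, max_lt_iff] using hm
  have hmem : ∀ t ∈ Set.Icc (0 : ℝ) 1, ((t : ℂ) * m.1, u₀ + m.2) ∈ Metric.ball ((0 : ℂ), u₀) r := by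
    intro t ht
    rw [Metric.mem_ball, dist_eq_norm, Prod.norm_def, max_lt_iff]
    refine ⟨?_, by simpa using hm'.2⟩
    simp only [Prod.mk_sub_mk, sub_zero, norm_mul, norm_real]
    refine lt_of_le_of_lt ?_ hm'.1
    rw [Real.norm_of_nonneg ht.1]
    exact mul_le_of_le_one_left (norm_nonneg _) ht.2
  have h := norm_sub_taylor_le hD hH m.1 (u₀ + m.2) (fun t ht => (hball _ (hmem t ht)).2) N
    (C := C * ‖m.1‖ ^ (N + 1)) fun t ht => (hball _ (hmem t ht)).1 m.1
  rw [Finset.sum_congr rfl fun n _ => inv_factorial_mul_dirDeriv F n m.1 (u₀ + m.2)] at h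
  simpa using h

/-- A coefficient varies by `O(|u|)` along the axis, so freezing it at `u₀` costs `|u| |z|^(i+j)`,
of weight at least six. -/
lemma isBigO_coeff_sub_mul (hF : AnalyticOnNhd ℝ F D) {u₀ : ℝ} (hu₀ : ((0 : ℂ), u₀) ∈ D)
    {i j : ℕ} (hij : 4 ≤ i + j) :
    (fun m : ℂ × ℝ => (coeff F i j (u₀ + m.2) - coeff F i j u₀) * m.1 ^ i * conj m.1 ^ j)
      =O[𝓝 0] fun m => ‖m.1‖ ^ 6 + |m.2| ^ 3 := by
  have h1 : DifferentiableAt ℝ (fun s : ℝ => coeff F i j (u₀ + s)) 0 := by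
    have h2 := (analyticOnNhd_wirtinger (analyticOnNhd_ofReal hF) i j _ hu₀).differentiableAt
    have h3 : DifferentiableAt ℝ (fun s : ℝ => ((0 : ℂ), u₀ + s)) 0 := by fun_prop
    have h4 : DifferentiableAt ℝ (fun s : ℝ =>
        (dzbar^[j] (dz^[i] fun m => (F m : ℂ))) ((0 : ℂ), u₀ + s)) 0 :=
      DifferentiableAt.comp (0 : ℝ) (by simpa using h2) h3
    exact h4.div_const _
  have h5 := h1.isBigO_sub
  simp only [add_zero, sub_zero] at h5
  have hsnd : Filter.Tendsto (fun m : ℂ × ℝ => m.2) (𝓝 0) (𝓝 0) := continuous_snd.tendsto 0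
  have h6 := (h5.comp_tendsto hsnd).mul
    (isBigO_refl (fun m : ℂ × ℝ => m.1 ^ i * conj m.1 ^ j) (𝓝 0)).norm_right
  refine (h6.trans (IsBigO.of_bound 1 ?_)).congr_left fun m => by
    simp only [Function.comp_apply]; ring
  filter_upwards [Metric.ball_mem_nhds (0 : ℂ × ℝ) one_pos] with m hm
  have hm' : ‖m.1‖ < 1 ∧ ‖m.2‖ < 1 := by
    simpa [Prod.norm_def, max_lt_iff] using hm
  have := pow_mul_pow_le_weighted (norm_nonneg m.1) hm'.1.le (norm_nonneg m.2) hm'.2.le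
    (j := i + j) (k := 1) (by omega)
  simp only [Function.comp_apply, norm_mul, norm_pow, RCLike.norm_conj, norm_norm, one_mul]
  rw [Real.norm_of_nonneg (r := ‖m.1‖ ^ 6 + |m.2| ^ 3) (by positivity), ← pow_add, mul_comm]
  simpa using this

lemma isBigO_of_isPrenormalizedOn (hD : IsOpen D) (hF : AnalyticOnNhd ℝ F D) {J : Set ℝ}
    (hJ : IsOpen J) (hpre : IsPrenormalizedOn F J) {u₀ : ℝ} (hu₀J : u₀ ∈ J)
    (hu₀ : ((0 : ℂ), u₀) ∈ D) :
    (fun m : ℂ × ℝ => (F (m.1, u₀ + m.2) : ℂ) - (m.1 * conj m.1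
      + coeff F 3 2 u₀ * m.1 ^ 3 * conj m.1 ^ 2 + coeff F 2 3 u₀ * m.1 ^ 2 * conj m.1 ^ 3))
      =O[𝓝 0] fun m => ‖m.1‖ ^ 6 + |m.2| ^ 3 := by
  have h1 := (isBigO_sub_taylor hD hF hu₀ 5).trans (k := fun m : ℂ × ℝ => ‖m.1‖ ^ 6 + |m.2| ^ 3)
    (IsBigO.of_bound 1 (.of_forall fun m => by
      rw [Real.norm_of_nonneg (by positivity), Real.norm_of_nonneg (by positivity), one_mul]
      exact le_add_of_nonneg_right (by positivity)))
  have h2 := (h1.add (isBigO_coeff_sub_mul hF hu₀ (i := 3) (j := 2) (by norm_num))).add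
    (isBigO_coeff_sub_mul hF hu₀ (i := 2) (j := 3) (by norm_num))
  refine h2.congr' ?_ .rfl
  have htend : Filter.Tendsto (fun m : ℂ × ℝ => u₀ + m.2) (𝓝 0) (𝓝 u₀) := by
    have : Continuous fun m : ℂ × ℝ => u₀ + m.2 := by fun_prop
    simpa using this.tendsto 0
  filter_upwards [htend.eventually (hJ.mem_nhds hu₀J)] with m hm
  have hm : u₀ + m.2 ∈ J := hm
  -- Among the `(i, j)` with `i + j ≤ 5` the normalizations leave only `(1, 1)`, `(3, 2)` and `(2,
  -- 3)`. They hold at `u₀ + m.2` because `J` is open.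
  simp only [Finset.sum_range_succ, Finset.sum_range_zero, Nat.sub_zero, Nat.sub_self,
    Nat.reduceSub, hpre.coeff_zero_right _ hm, hpre.coeff_zero_left _ hm,
    hpre.coeff_one_one _ hm, hpre.coeff_two_two _ hm, hpre.coeff_one_right _ hm 2 (by norm_num),
    hpre.coeff_one_right _ hm 3 (by norm_num), hpre.coeff_one_right _ hm 4 (by norm_num),
    hpre.coeff_one_left _ hm 2 (by norm_num), hpre.coeff_one_left _ hm 3 (by norm_num),
    hpre.coeff_one_left _ hm 4 (by norm_num)]
  ring

/-- Reality of `F` forces the coefficients of `z³ z̄²` and `z² z̄³` to be conjugate. -/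
lemma conj_eq_of_isBigO {F : ℂ × ℝ → ℝ} {a b : ℂ}
    (h : (fun m : ℂ × ℝ => (F m : ℂ) - (m.1 * conj m.1
      + a * m.1 ^ 3 * conj m.1 ^ 2 + b * m.1 ^ 2 * conj m.1 ^ 3))
      =O[𝓝 0] fun m => ‖m.1‖ ^ 6 + |m.2| ^ 3) : b = conj a := by
  have key : ∀ ζ : ℂ, (a * ζ ^ 3 * conj ζ ^ 2 + b * ζ ^ 2 * conj ζ ^ 3).im = 0 := by
    intro ζ
    have htend : Filter.Tendsto (fun t : ℝ => ((t : ℂ) * ζ, (0 : ℝ))) (𝓝 0) (𝓝 0) := by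
      have : Continuous fun t : ℝ => ((t : ℂ) * ζ, (0 : ℝ)) := by fun_prop
      simpa [Prod.zero_eq_mk] using this.tendsto 0
    have h1 : (fun t : ℝ => (a * ζ ^ 3 * conj ζ ^ 2 + b * ζ ^ 2 * conj ζ ^ 3).im * t ^ 5)
        =O[𝓝 0] fun t : ℝ => t ^ 6 := by
      refine IsBigO.trans (IsBigO.of_bound 1 (.of_forall fun t => ?_))
        ((h.comp_tendsto htend).trans (IsBigO.of_bound (‖ζ‖ ^ 6) (.of_forall fun t => ?_)))
      · have : (a * ζ ^ 3 * conj ζ ^ 2 + b * ζ ^ 2 * conj ζ ^ 3).im * t ^ 5 =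
            -((F (t * ζ, 0) : ℂ) - (t * ζ * conj (t * ζ) + a * (t * ζ) ^ 3 * conj (t * ζ) ^ 2
              + b * (t * ζ) ^ 2 * conj (t * ζ) ^ 3)).im := by
          simp only [pow_succ, pow_zero, one_mul, map_mul, conj_ofReal, add_im, sub_im, mul_re,
            mul_im, ofReal_re, ofReal_im, conj_re, conj_im]
          ring
        rw [this, one_mul, norm_neg]
        exact Complex.abs_im_le_norm _
      · simp [mul_pow, mul_comm]
    refine coeff_eq_zero_of_isBigO (n := 6) (c := fun k => match k with
      | 5 => (a * ζ ^ 3 * conj ζ ^ 2 + b * ζ ^ 2 * conj ζ ^ 3).im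
      | _ => 0) ((h1.mono nhdsWithin_le_nhds).congr_left fun t => ?_) 5 (by norm_num)
    simp only [Finset.sum_range_succ, Finset.sum_range_zero]
    ring
  -- `ζ = 1` gives `Im (a + b) = 0` and `ζ = i` gives `Re (a - b) = 0`.
  have h1 := key 1
  have h2 := key I
  simp only [pow_succ, pow_zero, one_mul, mul_one, map_one, conj_I, add_im, mul_re, mul_im, I_re,
    I_im, neg_re, neg_im] at h1 h2
  ring_nf at h1 h2
  refine Complex.ext ?_ ?_
  · rw [conj_re]; linarith
  · rw [conj_im]; linarith

end MoserChain

end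

/-! ### The theorem on Moser chains -/

theorem mainTheorem3 (D : Set (ℂ × ℝ)) (hD : IsOpen D)
    (F : ℂ × ℝ → ℝ) (hF : AnalyticOnNhd ℝ F D)
    (J : Set ℝ) (h0J : (0 : ℝ) ∈ J)
    (hF0 : ∀ u ∈ J, F (0, u) = 0)
    (hchain : MoserChain.IsMoserChain D F J (fun _ => 0) (fun _ => 0)) :
    (∀ a : ℂ,
      MoserChain.IsWeightedO6 (fun m => F m -
        (m.1 * starRingEnd ℂ m.1
          + a * m.1 ^ 3 * starRingEnd ℂ m.1 ^ 2
          + starRingEnd ℂ a * m.1 ^ 2 * starRingEnd ℂ m.1 ^ 3).re) →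
      a = 0) ∧
    (MoserChain.IsPrenormalizedOn F J →
      ∀ u ∈ J, MoserChain.coeff F 3 2 u = 0 ∧ MoserChain.coeff F 2 3 u = 0) := by
  have hmem : ∀ u ∈ J, ((0 : ℂ), u) ∈ D := fun u hu => by simpa using hchain.mem u hu
  -- Both parts are instances: `u = 0` for the first, every point of `J` for the second.
  have key : ∀ u ∈ J, ∀ a : ℂ,
      MoserChain.IsWeightedO6 (fun m => F (m.1, u + m.2) - MoserChain.modelFive a m.1) → a = 0 := by
    intro u hu a ha
    refine MoserChain.eq_zero_of_mem_chainLocus hD (hmem u hu) (hF _ (hmem u hu)).continuousAt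
      ?_ ?_ ha
    · filter_upwards [hchain.isOpen.mem_nhds hu] with v hv using hF0 v hv
    · simpa using hchain.jet_mem u hu
  refine ⟨fun a ha => key 0 h0J a ?_, fun hpre u hu => ?_⟩
  · simpa [MoserChain.modelFive] using ha
  · have h := MoserChain.isBigO_of_isPrenormalizedOn hD hF hchain.isOpen hpre hu (hmem u hu)
    have hconj := MoserChain.conj_eq_of_isBigO (F := fun m => F (m.1, u + m.2)) h
    have h32 : MoserChain.coeff F 3 2 u = 0 := by
      refine key u hu _ ?_
      rw [hconj] at h
      refine (IsBigO.of_bound 1 (.of_forall fun m => ?_)).trans h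
      rw [one_mul]
      refine le_trans (le_of_eq ?_) (Complex.abs_re_le_norm _)
      rw [sub_re, ofReal_re, MoserChain.modelFive, Real.norm_eq_abs]
    exact ⟨h32, by rw [hconj, h32, map_zero]⟩
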